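/- Setting. Let $n\ge 0$, let $l_1,\dots,l_n\in\mathbb R$ be the losses given default, and for $j\in\{0,1\}^n$ (a scenario; $j_i=1$ iff counterparty $i$ defaults) let $L_j=\sum_i j_i l_i$ and $L_M=\sum_i l_i$. Let $\theta:\mathbb R\to\mathbb R$ be additive, $\theta_0\in\mathbb R$, and $\alpha_j=\theta_0+\theta(L_j)$. Registers: $C$ ($n$ qubits), $T$ and $B$ (one qubit each), $Z$ ($z\ge 0$ qubits). The circuit $A$ applies to $T$ the rotation $R_y(2\theta_0)$ and then, for $i=1,\dots,n$, the rotation $R_y(2\theta(l_i))$ controlled by the $i$-th qubit of $C$. With $\Pi=|0\rangle\langle 0|_T$, $\tilde\Pi=|1\rangle\langle 1|_T$ and phases $\Phi=(\phi_1,\dots,\phi_d)\in\mathbb R^d$ let $Q=Q(\Phi)=H_B\,Q_d\cdots Q_1\,H_B$, where $Q_i=R_iA$ for odd $i$ and $Q_i=\tilde R_iA^\dagger$ for even $i$; here $R_i$ (resp. $\tilde R_i$) is an $X$ gate on $B$ controlled by $\Pi$ (resp. $\tilde\Pi$), followed by $R_z(2\phi_i)$ on $B$, followed by the same controlled $X$.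 Call a real polynomial $P$ admissible if it is even, non-constant and $|P|\le 1$ on $[-1,1]$. For $k,\mu\in(0,1)$ and $\varepsilon,\delta>0$, say that $P$ $(\varepsilon,\delta)$-approximates $k\mathbf 1_{|x|\le\mu}$ if for all $x\in[-1,1]$ one has $|P(x)-k\mathbf 1_{|x|\le\mu}|<\varepsilon$ when $||x|-\mu|>\delta$, and $|P(x)-k\mathbf 1_{|x|\le\mu}|\le k/2$ when $||x|-\mu|\le\delta$. Theorem. (1) For every $j$, $A|j\rangle_C|0\rangle_T=\cos(\theta_0+\theta(L_j))|j\rangle_C|0\rangle_T+\sin(\theta_0+\theta(L_j))|j\rangle_C|1\rangle_T$, and $\tilde\Pi A\Pi=\sum_j\sin(\alpha_j)\,|j\rangle\langle j|_C\otimes|1\rangle\langle 0|_T$. (2) For all $k,\mu\in(0,1)$ and $\varepsilon,\delta>0$ there is an admissible polynomial that $(\varepsilon,\delta)$-approximates $k\mathbf 1_{|x|\le\mu}$. (3) For every admissible $P$, of degree $d$, there is $\Phi\in\mathbb R^d$, depending on $P$ only, such that for all $n,l,\theta,\theta_0$ as above $$|0\rangle\langle 0|_B\,\Pi\,Q\,\Pi\,|0\rangle\langle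 0|_B=\sum_j P(\sin\alpha_j)\,|j\rangle\langle j|_C\otimes|0\rangle\langle 0|_T\otimes|0\rangle\langle 0|_B .$$ Moreover, let $(p_j)_{j\in\{0,1\}^n}$ be a probability distribution and $U$ a unitary on $Z,C$ with $U|0\rangle_Z|0\rangle_C=\sum_j\sqrt{p_j}\,|\psi_j\rangle_Z|j\rangle_C$ for unit vectors $\psi_j$. Then the component of $QU|0\rangle_Z|0\rangle_C|0\rangle_T|0\rangle_B$ with $T$ and $B$ in the state $|0\rangle$ is $\sum_j P(\sin\alpha_j)\sqrt{p_j}\,|\psi_j\rangle_Z|j\rangle_C|0\rangle_T|0\rangle_B$, so that the probability of measuring $0$ on both $T$ and $B$ is $$\mathrm{Pr}=\sum_j p_j\,P(\sin\alpha_j)^2 ,$$ and if $P$ $(\varepsilon,\delta)$-approximates $k\mathbf 1_{|x|\le\mu}$, with $k,\mu\in(0,1)$ and $\varepsilon,\delta>0$, then $$\Bigl|\mathrm{Pr}-\sum_{j:\,|\sin\alpha_j|\le\mu}k^2p_j\Bigr|\le \varepsilon(2k+\varepsilon)+\tfrac54k^2\sum_{j:\,||\sin\alpha_j|-\mu|\le\delta}p_j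 .$$ (4) Suppose that all $l_i\ge 0$, that $k,\mu\in(0,1)$ and $0<L_T<L_M$, and that $\sin(\theta(x)+\theta_0)\in[0,\mu)$ for all real $x\in[0,L_T)$ and $\sin(\theta(x)+\theta_0)\in(\mu,1]$ for all real $x\in(L_T,L_M]$. Then for every probability distribution $(p_j)$ $$\sum_{j:\,|\sin\alpha_j|\le\mu}k^2p_j=k^2F(L_T),$$ where $F(x)=\sum_{j:\,L_j\le x}p_j$ is the cumulative distribution function of the total loss. (5) For all $n$, $d$, $\Phi\in\mathbb R^d$, $l$, $\theta$, $\theta_0$, the operator $Q(\Phi)$ is implemented by the circuit obtained by concatenating the gates listed above (with $A^\dagger$ implemented by the inverse circuit of $A$; the controlled $X$ gates are controlled by the qubit $T$), whose elementary gates are $H$, $X$, $R_y$, $R_z$ and singly controlled versions of them. The depth of this circuit (each elementary gate takes one time step, gates on disjoint qubits may run in parallel) is $O(dn)$: there is an absolute constant $K$ such that it is at most $K\,d\,n$ whenever $n,d\ge 1$. -/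

import Mathlib

open scoped Matrix Polynomial

noncomputable section

namespace LossCDF

/-! ### Gates, circuits, logical depth

Every wire of a finite set `W` carries one qubit; the computational basis is indexed by
`W → Fin 2`, and an operator is a complex matrix indexed by that basis. -/

/-- The one-qubit gates that occur: Hadamard, NOT, rotations about `y` and about `z`. -/
inductive OneQubit : Type
  | h : OneQubit
  | x : OneQubit
  | ry (a : ℝ) : OneQubit
  | rz (a : ℝ) : OneQubit

def OneQubit.toMatrix : OneQubit → Matrix (Fin 2) (Fin 2) ℂ
  | .h => (((Real.sqrt 2)⁻¹ : ℝ) : ℂ) • !![1, 1; 1, -1]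
  | .x => !![0, 1; 1, 0]
  | .ry a => !![((Real.cos (a / 2) : ℝ) : ℂ), -((Real.sin (a / 2) : ℝ) : ℂ);
                ((Real.sin (a / 2) : ℝ) : ℂ), ((Real.cos (a / 2) : ℝ) : ℂ)]
  | .rz a => !![Complex.exp (-(Complex.I * ((a / 2 : ℝ) : ℂ))), 0;
                0, Complex.exp (Complex.I * ((a / 2 : ℝ) : ℂ))]

/-- The inverse gate. -/
def OneQubit.dagger : OneQubit → OneQubit
  | .h => .h
  | .x => .x
  | .ry a => .ry (-a)
  | .rz a => .rz (-a)

/-- An elementary gate: a one-qubit gate on the wire `t`, or a one-qubit gate on `t` that is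
applied exactly when the wire `c` has the value `v` (`v = 1`: control, `v = 0`: open control). -/
inductive Gate (W : Type) : Type
  | single (u : OneQubit) (t : W) : Gate W
  | ctrl (c : W) (v : Fin 2) (u : OneQubit) (t : W) (h : c ≠ t) : Gate W

variable {W : Type} [Fintype W] [DecidableEq W]

/-- The one-qubit matrix `u` on the wire `t`, the identity on all other wires. -/
def onWire (u : Matrix (Fin 2) (Fin 2) ℂ) (t : W) : Matrix (W → Fin 2) (W → Fin 2) ℂ :=
  Matrix.of fun r s => if ∀ w, w ≠ t → r w = s w then u (r t) (s t) else 0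

def Gate.toMatrix : Gate W → Matrix (W → Fin 2) (W → Fin 2) ℂ
  | .single u t => onWire u.toMatrix t
  | .ctrl c v u t _ => Matrix.of fun r s =>
      if s c = v then onWire u.toMatrix t r s
      else (1 : Matrix (W → Fin 2) (W → Fin 2) ℂ) r s

def Gate.dagger : Gate W → Gate W
  | .single u t => .single u.dagger t
  | .ctrl c v u t h => .ctrl c v u.dagger t h

def Gate.wires : Gate W → Finset W
  | .single _ t => {t}
  | .ctrl c _ _ t _ => {c, t}

/-- A circuit: the list of its gates, the first one is applied first. -/
abbrev Circuit (W : Type) : Type := List (Gate W)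

def Circuit.toMatrix : Circuit W → Matrix (W → Fin 2) (W → Fin 2) ℂ
  | [] => 1
  | g :: c => Circuit.toMatrix c * g.toMatrix

/-- The inverse circuit. -/
def Circuit.dagger (c : Circuit W) : Circuit W := (c.map Gate.dagger).reverse

/-- The time step at which each wire becomes free when every gate takes one time step and is
executed as soon as all its wires are free. -/
def Circuit.clock (c : Circuit W) : W → ℕ :=
  c.foldl (fun τ g w => if w ∈ g.wires then g.wires.sup τ + 1 else τ w) (fun _ => 0)

/-- Logical depth. -/
def Circuit.depth (c : Circuit W) : ℕ := Finset.univ.sup (Circuit.clock c)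

/-! ### Quantum singular value transformation -/

/-- The projector `|v⟩⟨v|` on the wire `t`. -/
def wireProj (t : W) (v : Fin 2) : Matrix (W → Fin 2) (W → Fin 2) ℂ :=
  Matrix.diagonal fun s => if s t = v then 1 else 0

/-- NOT on the wire `b`, controlled by the projector `R`. -/
def projCtrlX (b : W) (R : Matrix (W → Fin 2) (W → Fin 2) ℂ) :
    Matrix (W → Fin 2) (W → Fin 2) ℂ :=
  R * onWire OneQubit.x.toMatrix b + (1 - R)

/-- Controlled NOT, rotation about `z` on `b`, controlled NOT. -/
def phaseOp (b : W) (R : Matrix (W → Fin 2) (W → Fin 2) ℂ) (φ : ℝ) :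
    Matrix (W → Fin 2) (W → Fin 2) ℂ :=
  projCtrlX b R * onWire (OneQubit.rz (2 * φ)).toMatrix b * projCtrlX b R

/-- The operator `H_B Q_d ⋯ Q_1 H_B`, where `Q_j = R_j O` for odd `j` and `Q_j = R̃_j O†` for
even `j`, with `R_j`, `R̃_j` built from the projectors `R`, `R'`. The phase `φ_j` is `Φ (j - 1)`. -/
def qsvtOperator (b : W) (O R R' : Matrix (W → Fin 2) (W → Fin 2) ℂ) {d : ℕ} (Φ : Fin d → ℝ) :
    Matrix (W → Fin 2) (W → Fin 2) ℂ :=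
  onWire OneQubit.h.toMatrix b *
    (List.ofFn fun i : Fin d =>
      if Even (i : ℕ) then phaseOp b R (Φ i) * O else phaseOp b R' (Φ i) * Oᴴ).reverse.prod *
    onWire OneQubit.h.toMatrix b

/-! ### The registers `C` (`n` qubits), `T` and `B` (one qubit each) -/

abbrev QWire (n : ℕ) : Type := Fin n ⊕ Fin 2

abbrev cWire {n : ℕ} (i : Fin n) : QWire n := Sum.inl i
abbrev tWire (n : ℕ) : QWire n := Sum.inr 0
abbrev bWire (n : ℕ) : QWire n := Sum.inr 1

/-- The basis label of `|j⟩_C |t⟩_T |b⟩_B`. -/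
def label {n : ℕ} (j : Fin n → Fin 2) (t b : Fin 2) : QWire n → Fin 2 := Sum.elim j ![t, b]

/-- The basis vector `|j⟩_C |t⟩_T |b⟩_B`. -/
def ket {n : ℕ} (j : Fin n → Fin 2) (t b : Fin 2) : (QWire n → Fin 2) → ℂ :=
  Pi.single (label j t b) 1

/-- The rank-one operator `|v⟩⟨w|`. -/
def ketbra {ι : Type} (v w : ι → ℂ) : Matrix ι ι ℂ := Matrix.vecMulVec v (star w)

/-! ### Losses -/

/-- The total loss in the scenario with default indicators `j`. -/
def totalLoss {n : ℕ} (l : Fin n → ℝ) (j : Fin n → Fin 2) : ℝ :=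
  ∑ i, (((j i : Fin 2) : ℕ) : ℝ) * l i

/-- The loss in the scenario in which all counterparties default. -/
def maxLoss {n : ℕ} (l : Fin n → ℝ) : ℝ := totalLoss l (fun _ => 1)

/-- The cumulative distribution function of the total loss. -/
def lossCDF {n : ℕ} (p : PMF (Fin n → Fin 2)) (l : Fin n → ℝ) (x : ℝ) : ℝ :=
  ProbabilityTheory.cdf (p.toMeasure.map (totalLoss l)) x

/-- The angle `α_j = θ(L_j) + θ₀`. -/
def angle {n : ℕ} (l : Fin n → ℝ) (θ : ℝ →+ ℝ) (θ₀ : ℝ) (j : Fin n → Fin 2) : ℝ :=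
  θ₀ + θ (totalLoss l j)

/-! ### Amplitude loading and its singular value transformation -/

/-- `R_y(2θ₀)` on `T`, then for every `i` the rotation `R_y(2θ(l_i))` on `T` controlled by the
`i`-th qubit of `C`. -/
def loadCircuit {n : ℕ} (l : Fin n → ℝ) (θ : ℝ →+ ℝ) (θ₀ : ℝ) : Circuit (QWire n) :=
  Gate.single (.ry (2 * θ₀)) (tWire n) ::
    List.ofFn fun i : Fin n => Gate.ctrl (cWire i) 1 (.ry (2 * θ (l i))) (tWire n) (by simp)

/-- The operator `A`. -/
def loadOp {n : ℕ} (l : Fin n → ℝ) (θ : ℝ →+ ℝ) (θ₀ : ℝ) :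
    Matrix (QWire n → Fin 2) (QWire n → Fin 2) ℂ :=
  (loadCircuit l θ θ₀).toMatrix

/-- The circuit of `R_j`: the NOTs on `B` are controlled by the value `v` of `T`. -/
def phaseCircuit (n : ℕ) (v : Fin 2) (φ : ℝ) : Circuit (QWire n) :=
  [Gate.ctrl (tWire n) v .x (bWire n) (by simp),
   Gate.single (.rz (2 * φ)) (bWire n),
   Gate.ctrl (tWire n) v .x (bWire n) (by simp)]

/-- The circuit of `Q`. -/
def qsvtCircuit {n : ℕ} (l : Fin n → ℝ) (θ : ℝ →+ ℝ) (θ₀ : ℝ) {d : ℕ} (Φ : Fin d → ℝ) :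
    Circuit (QWire n) :=
  [Gate.single .h (bWire n)] ++
    (List.ofFn fun i : Fin d =>
      if Even (i : ℕ) then loadCircuit l θ θ₀ ++ phaseCircuit n 0 (Φ i)
      else (loadCircuit l θ θ₀).dagger ++ phaseCircuit n 1 (Φ i)).flatten ++
    [Gate.single .h (bWire n)]

/-- The operator `Q` obtained from `A` with the projectors `|0⟩⟨0|_T` and `|1⟩⟨1|_T`. -/
def qOp {n : ℕ} (l : Fin n → ℝ) (θ : ℝ →+ ℝ) (θ₀ : ℝ) {d : ℕ} (Φ : Fin d → ℝ) :
    Matrix (QWire n → Fin 2) (QWire n → Fin 2) ℂ :=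
  qsvtOperator (bWire n) (loadOp l θ θ₀) (wireProj (tWire n) 0) (wireProj (tWire n) 1) Φ

/-! ### The uncertainty model and the full circuit -/

/-- `U` is a unitary on `Z` (`z` qubits) and `C` with
`U |0⟩_Z |0⟩_C = ∑_j √p_j |ψ_j⟩_Z |j⟩_C`, every `ψ_j` normalized. -/
structure LoadsScenarios {z n : ℕ}
    (U : Matrix ((Fin z → Fin 2) × (Fin n → Fin 2)) ((Fin z → Fin 2) × (Fin n → Fin 2)) ℂ)
    (p : PMF (Fin n → Fin 2)) (ψ : (Fin n → Fin 2) → (Fin z → Fin 2) → ℂ) : Prop where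
  unitary : U ∈ Matrix.unitaryGroup ((Fin z → Fin 2) × (Fin n → Fin 2)) ℂ
  normalized : ∀ j, ∑ a, ‖ψ j a‖ ^ 2 = 1
  apply_zero : ∀ a j, (U *ᵥ Pi.single (0, 0) 1) (a, j) = ((Real.sqrt (p j).toReal : ℝ) : ℂ) * ψ j a

/-- `U` as an operator on all registers, trivial on `T` and `B`. -/
def extendU {z n : ℕ}
    (U : Matrix ((Fin z → Fin 2) × (Fin n → Fin 2)) ((Fin z → Fin 2) × (Fin n → Fin 2)) ℂ) :
    Matrix ((Fin z → Fin 2) × (QWire n → Fin 2)) ((Fin z → Fin 2) × (QWire n → Fin 2)) ℂ :=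
  Matrix.of fun r s =>
    if r.2 (tWire n) = s.2 (tWire n) ∧ r.2 (bWire n) = s.2 (bWire n) then
      U (r.1, fun i => r.2 (cWire i)) (s.1, fun i => s.2 (cWire i))
    else 0

/-- `Q` as an operator on all registers, trivial on `Z`. -/
def extendQ {n : ℕ} (z : ℕ) (Q : Matrix (QWire n → Fin 2) (QWire n → Fin 2) ℂ) :
    Matrix ((Fin z → Fin 2) × (QWire n → Fin 2)) ((Fin z → Fin 2) × (QWire n → Fin 2)) ℂ :=
  Matrix.kronecker (1 : Matrix (Fin z → Fin 2) (Fin z → Fin 2) ℂ) Q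

/-- The state `Q U |0⟩_Z |0⟩_C |0⟩_T |0⟩_B`. -/
def finalState {z n : ℕ}
    (U : Matrix ((Fin z → Fin 2) × (Fin n → Fin 2)) ((Fin z → Fin 2) × (Fin n → Fin 2)) ℂ)
    (Q : Matrix (QWire n → Fin 2) (QWire n → Fin 2) ℂ) :
    (Fin z → Fin 2) × (QWire n → Fin 2) → ℂ :=
  extendQ z Q *ᵥ (extendU U *ᵥ Pi.single (0, 0) 1)

/-- The probability of measuring `0` both on `T` and on `B`. -/
def probZero {z n : ℕ} (v : (Fin z → Fin 2) × (QWire n → Fin 2) → ℂ) : ℝ :=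
  ∑ s, if s.2 (tWire n) = 0 ∧ s.2 (bWire n) = 0 then ‖v s‖ ^ 2 else 0

/-! ### Polynomials -/

/-- The threshold function `1_{|x| ≤ μ}`. -/
def threshold (μ x : ℝ) : ℝ := if |x| ≤ μ then 1 else 0

/-- A non-constant even real polynomial bounded by `1` in absolute value on `[-1, 1]`. -/
structure Admissible (P : ℝ[X]) : Prop where
  even : ∀ x, P.eval (-x) = P.eval x
  nonconst : 0 < P.natDegree
  bounded : ∀ x ∈ Set.Icc (-1 : ℝ) 1, |P.eval x| ≤ 1

/-- `P` approximates `k · 1_{|x| ≤ μ}` on `[-1, 1]`: up to `ε` at distance more than `δ` from the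
jumps `±μ`, and up to half the height of the jump near them. -/
structure ApproxThreshold (P : ℝ[X]) (k μ ε δ : ℝ) : Prop where
  far : ∀ x ∈ Set.Icc (-1 : ℝ) 1, δ < abs (|x| - μ) → |P.eval x - k * threshold μ x| < ε
  near : ∀ x ∈ Set.Icc (-1 : ℝ) 1, abs (|x| - μ) ≤ δ → |P.eval x - k * threshold μ x| ≤ k / 2

end LossCDF

end

noncomputable section

namespace LossCDF

/-! ### Circuits -/

/-! Everything reduces to products of 2×2 matrices on T. For fixed `j`, the operator `A` is the
rotation R_y(2α_j), since rotations about one axis add their angles and θ is additive. Between its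
two Hadamards, `Q` is block diagonal over the basis states of C and B (`tBlock`). With B in state 0,
negated phases and an even number of factors, a block is e^{iφ_d Z} W ⋯ e^{iφ_1 Z} W, where W is the
reflection with signal sin α_j (`alternatingProd_neg`); with B in state 1 it is the complex
conjugate. The Hadamards average the two, so the relevant entry of `Q` is a real part
(`qOp_label_zero`).

It remains to find phases for which this real part is P. Since 1 - P² is a polynomial in x² that is
nonnegative on [-1, 1], a Markov–Lukács theorem (`isWeightedSumSq_of_nonneg`) writes it as B² + (1 -
x²)D². The pair P + iB, iD is then normalized, and one phase and one reflection at a time can be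
peeled off it, each lowering the degree by one (`exists_signalProd_of_normalized`).

A threshold polynomial comes from Weierstrass approximation of a continuous positive factor that
turns μ² - x² into a step. The error in the probability is estimated scenario by scenario.

In the identification with the distribution function only L_j = L_T is delicate: the hypotheses
leave out this point and θ need not be continuous. Exponential sums show that e^{iθ(x)} comes
arbitrarily close to 1 on (0, L_T], which transfers the bound from [0, L_T) to L_T
(`abs_sin_le_of_forall_Ico`).

The depth is bounded by the number of gates. -/

theorem Circuit.clock_le_length {W : Type} [DecidableEq W] (c : Circuit W) (w : W) :
    Circuit.clock c w ≤ c.length := by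
  -- The fold changes its starting clock, so the induction needs an arbitrary start bounded by some
  -- `k`.
  suffices H : ∀ (c : Circuit W) (τ : W → ℕ) (k : ℕ), (∀ w, τ w ≤ k) → ∀ w,
      c.foldl (fun τ g w => if w ∈ g.wires then g.wires.sup τ + 1 else τ w) τ w
        ≤ k + c.length by
    simpa [Circuit.clock] using H c (fun _ => 0) 0 (fun _ => le_rfl) w
  intro c
  induction c with
  | nil => intro τ k h w; simpa using h w
  | cons g c ih =>
    intro τ k h w
    rw [List.foldl_cons, List.length_cons, ← add_assoc, add_right_comm]
    refine ih _ (k + 1) (fun w => ?_) w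
    split_ifs
    · exact Nat.succ_le_succ (Finset.sup_le fun w _ => h w)
    · exact (h w).trans (Nat.le_succ k)

section Circuits

variable {W : Type} [Fintype W] [DecidableEq W]

theorem OneQubit.toMatrix_dagger (u : OneQubit) : u.dagger.toMatrix = u.toMatrixᴴ := by
  cases u with
  | h =>
    ext i j
    fin_cases i <;> fin_cases j <;> simp [OneQubit.dagger, OneQubit.toMatrix]
  | x =>
    ext i j
    fin_cases i <;> fin_cases j <;> simp [OneQubit.dagger, OneQubit.toMatrix]
  | ry a =>
    ext i j
    fin_cases i <;> fin_cases j <;>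
      simp [OneQubit.dagger, OneQubit.toMatrix, neg_div, -Complex.ofReal_div,
        -Complex.ofReal_cos, -Complex.ofReal_sin, Complex.conj_ofReal]
  | rz a =>
    ext i j
    fin_cases i <;> fin_cases j <;>
      simp [OneQubit.dagger, OneQubit.toMatrix, neg_div, ← Complex.exp_conj, Complex.conj_ofNat]

theorem onWire_conjTranspose (u : Matrix (Fin 2) (Fin 2) ℂ) (t : W) :
    onWire uᴴ t = (onWire u t)ᴴ := by
  ext r s
  simp only [onWire, Matrix.of_apply, Matrix.conjTranspose_apply]
  have : (∀ w, w ≠ t → r w = s w) ↔ ∀ w, w ≠ t → s w = r w :=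
    forall₂_congr fun _ _ => eq_comm
  by_cases h : ∀ w, w ≠ t → s w = r w
  · rw [if_pos h, if_pos (this.2 h)]
  · rw [if_neg h, if_neg (fun h' => h (this.1 h'))]; simp

/-- A controlled gate tests its control on the column index only. As control and target differ,
entries between labels that disagree on the control vanish, so the test is symmetric where it
matters. -/
theorem Gate.toMatrix_dagger (g : Gate W) : g.dagger.toMatrix = g.toMatrixᴴ := by
  cases g with
  | single u t => simp [Gate.dagger, Gate.toMatrix, OneQubit.toMatrix_dagger, onWire_conjTranspose]
  | ctrl c v u t h =>
    ext r s
    simp only [Gate.dagger, Gate.toMatrix, OneQubit.toMatrix_dagger, onWire_conjTranspose,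
      Matrix.of_apply, Matrix.conjTranspose_apply]
    by_cases hc : r c = s c
    · rw [hc]
      split_ifs
      · rfl
      · rw [← Matrix.conjTranspose_apply, Matrix.conjTranspose_one]
    · have h1 : ¬ ∀ w, w ≠ t → s w = r w := fun h' => hc (h' c h).symm
      have h2 : r ≠ s := fun h' => hc (by rw [h'])
      simp [onWire, h1, h2, h2.symm]

theorem Circuit.toMatrix_append (c c' : Circuit W) :
    Circuit.toMatrix (c ++ c') = Circuit.toMatrix c' * Circuit.toMatrix c := by
  induction c with
  | nil => simp [Circuit.toMatrix]
  | cons g c ih => simp only [List.cons_append, Circuit.toMatrix]; rw [ih, Matrix.mul_assoc]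

theorem Circuit.toMatrix_flatten (L : List (Circuit W)) :
    Circuit.toMatrix L.flatten = (L.map Circuit.toMatrix).reverse.prod := by
  induction L with
  | nil => simp [Circuit.toMatrix]
  | cons c L ih => simp [Circuit.toMatrix_append, ih]

theorem Circuit.toMatrix_dagger (c : Circuit W) :
    Circuit.toMatrix c.dagger = (Circuit.toMatrix c)ᴴ := by
  induction c with
  | nil => simp [Circuit.toMatrix, Circuit.dagger]
  | cons g c ih =>
    have : Circuit.dagger (g :: c) = Circuit.dagger c ++ [g.dagger] := by
      simp [Circuit.dagger]
    rw [this, Circuit.toMatrix_append, ih]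
    simp [Circuit.toMatrix, Gate.toMatrix_dagger]

theorem toMatrix_ctrl_x (c b : W) (v : Fin 2) (h : c ≠ b) :
    (Gate.ctrl c v .x b h).toMatrix = projCtrlX b (wireProj c v) := by
  ext r s
  simp only [Gate.toMatrix, projCtrlX, wireProj, Matrix.of_apply, Matrix.add_apply,
    Matrix.diagonal_mul, Matrix.sub_apply]
  by_cases hc : r c = s c
  · by_cases hv : s c = v
    · by_cases hrs : r = s
      · subst hrs; simp [hv]
      · simp [hc, hv, hrs]
    · by_cases hrs : r = s
      · subst hrs; simp [hv]
      · simp [hc, hv, hrs]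
  · have h1 : ¬ ∀ w, w ≠ b → r w = s w := fun h' => hc (h' c h)
    have h2 : r ≠ s := fun h' => hc (by rw [h'])
    simp [onWire, h1, h2]

theorem Circuit.depth_le_length (c : Circuit W) : Circuit.depth c ≤ c.length :=
  Finset.sup_le fun w _ => Circuit.clock_le_length c w

end Circuits

theorem toMatrix_phaseCircuit (n : ℕ) (v : Fin 2) (φ : ℝ) :
    Circuit.toMatrix (phaseCircuit n v φ) = phaseOp (bWire n) (wireProj (tWire n) v) φ := by
  simp only [phaseCircuit, Circuit.toMatrix, toMatrix_ctrl_x, phaseOp, Matrix.one_mul]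
  rfl

theorem toMatrix_qsvtCircuit {n d : ℕ} (l : Fin n → ℝ) (θ : ℝ →+ ℝ) (θ₀ : ℝ) (Φ : Fin d → ℝ) :
    (qsvtCircuit l θ θ₀ Φ).toMatrix = qOp l θ θ₀ Φ := by
  rw [qsvtCircuit, Circuit.toMatrix_append, Circuit.toMatrix_append, Circuit.toMatrix_flatten,
    qOp, qsvtOperator, List.map_ofFn, Matrix.mul_assoc]
  have : (Circuit.toMatrix ∘ fun i : Fin d =>
      if Even (i : ℕ) then loadCircuit l θ θ₀ ++ phaseCircuit n 0 (Φ i)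
      else (loadCircuit l θ θ₀).dagger ++ phaseCircuit n 1 (Φ i)) = fun i : Fin d =>
      if Even (i : ℕ) then phaseOp (bWire n) (wireProj (tWire n) 0) (Φ i) * loadOp l θ θ₀
      else phaseOp (bWire n) (wireProj (tWire n) 1) (Φ i) * (loadOp l θ θ₀)ᴴ := by
    funext i
    simp only [Function.comp]
    split_ifs
    · rw [Circuit.toMatrix_append, toMatrix_phaseCircuit, loadOp]
    · rw [Circuit.toMatrix_append, toMatrix_phaseCircuit, loadOp, Circuit.toMatrix_dagger]
  rw [this]
  simp [Circuit.toMatrix, Gate.toMatrix]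

theorem length_qsvtCircuit {n d : ℕ} (l : Fin n → ℝ) (θ : ℝ →+ ℝ) (θ₀ : ℝ) (Φ : Fin d → ℝ) :
    (qsvtCircuit l θ θ₀ Φ).length = d * (n + 4) + 2 := by
  have : (List.length ∘ fun i : Fin d =>
      if Even (i : ℕ) then loadCircuit l θ θ₀ ++ phaseCircuit n 0 (Φ i)
      else (loadCircuit l θ θ₀).dagger ++ phaseCircuit n 1 (Φ i)) = fun _ => n + 4 := by
    funext i
    simp only [Function.comp]
    split_ifs <;> simp [loadCircuit, phaseCircuit, Circuit.dagger]
  simp only [qsvtCircuit, List.length_append, List.length_flatten, List.map_ofFn, this]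
  simp only [List.ofFn_const, List.sum_replicate, smul_eq_mul, List.length_singleton]
  ring

theorem depth_qsvtCircuit_le {n d : ℕ} (l : Fin n → ℝ) (θ : ℝ →+ ℝ) (θ₀ : ℝ) (Φ : Fin d → ℝ)
    (hn : 1 ≤ n) (hd : 1 ≤ d) : (qsvtCircuit l θ θ₀ Φ).depth ≤ 7 * (d * n) := by
  refine (Circuit.depth_le_length _).trans ?_
  rw [length_qsvtCircuit]
  nlinarith [Nat.mul_le_mul hd hn, Nat.mul_le_mul_left d hn]

section

open Polynomial

/-! ### Polynomials of given parity and bounded degree -/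

section Parity

variable {R : Type*} [CommRing R] {m n : ℕ} {p q : R[X]}

/-- All monomials of `p` have degree at most `n` and of the same parity as `n`. -/
def HasParity (n : ℕ) (p : R[X]) : Prop := ∀ k, p.coeff k ≠ 0 → k ≤ n ∧ Even (n + k)

theorem HasParity.zero (n : ℕ) : HasParity n (0 : R[X]) := fun k h => by simp at h

theorem HasParity.add (hp : HasParity n p) (hq : HasParity n q) : HasParity n (p + q) := by
  intro k hk
  by_cases h : p.coeff k = 0
  · exact hq k fun h' => hk (by simp [h, h'])
  · exact hp k h

theorem HasParity.neg (hp : HasParity n p) : HasParity n (-p) := fun k hk =>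
  hp k fun h => hk (by simp [h])

theorem HasParity.sub (hp : HasParity n p) (hq : HasParity n q) : HasParity n (p - q) := by
  rw [sub_eq_add_neg]; exact hp.add hq.neg

theorem HasParity.mul (hp : HasParity m p) (hq : HasParity n q) :
    HasParity (m + n) (p * q) := by
  intro k hk
  rw [coeff_mul] at hk
  obtain ⟨⟨i, j⟩, hij, h⟩ := Finset.exists_ne_zero_of_sum_ne_zero hk
  rw [Finset.HasAntidiagonal.mem_antidiagonal] at hij
  obtain ⟨h1, h2⟩ := hp i fun h' => h (by simp [h'])
  obtain ⟨h3, h4⟩ := hq j fun h' => h (by simp [h'])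
  simp only at hij
  refine ⟨by omega, ?_⟩
  rw [Nat.even_iff] at *
  omega

theorem HasParity.C (r : R) : HasParity 0 (C r) := by
  intro k hk
  rw [coeff_C] at hk
  have : k = 0 := by by_contra h; simp [h] at hk
  simp [this]

theorem HasParity.X : HasParity 1 (X : R[X]) := by
  intro k hk
  rw [coeff_X] at hk
  have : k = 1 := by by_contra h; exact hk (if_neg (Ne.symm h))
  simp [this]

theorem HasParity.C_mul (r : R) (hp : HasParity n p) : HasParity n (Polynomial.C r * p) := by
  simpa using (HasParity.C r).mul hp

theorem HasParity.mono (hp : HasParity n p) : HasParity (n + 2) p := by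
  intro k hk
  obtain ⟨h1, h2⟩ := hp k hk
  refine ⟨by omega, ?_⟩
  rw [Nat.even_iff] at *
  omega

theorem HasParity.of_X_mul_X_mul (hp : HasParity n (Polynomial.X * (Polynomial.X * p))) :
    HasParity n p := by
  intro k hk
  obtain ⟨h1, h2⟩ := hp (k + 2) (by rwa [coeff_X_mul, coeff_X_mul])
  refine ⟨by omega, ?_⟩
  rw [Nat.even_iff] at *
  omega

/-- In products, the second components are controlled only after multiplication by `X`, hence the
hypothesis on `X * (X * p)`; removing both factors preserves the parity. -/
theorem HasParity.one_sub_X_sq_mul (hp : HasParity n (Polynomial.X * (Polynomial.X * p))) :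
    HasParity n ((1 - Polynomial.X ^ 2) * p) := by
  have : (1 - Polynomial.X ^ 2) * p = p - Polynomial.X * (Polynomial.X * p) := by ring
  rw [this]
  exact hp.of_X_mul_X_mul.sub hp

/-- Parity already excludes degree `n + 1`, so one vanishing coefficient lowers the bound by two. -/
theorem HasParity.of_coeff_eq_zero (hp : HasParity (n + 2) p) (h : p.coeff (n + 2) = 0) :
    HasParity n p := by
  intro k hk
  obtain ⟨h1, h2⟩ := hp k hk
  have : k ≠ n + 2 := fun h' => hk (h' ▸ h)
  rw [Nat.even_iff] at *
  omega

theorem HasParity.natDegree_le (hp : HasParity n p) : p.natDegree ≤ n := by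
  rw [natDegree_le_iff_coeff_eq_zero]
  intro k hk
  by_contra h
  exact absurd (hp k h).1 (by omega)

theorem HasParity.map {S : Type*} [CommRing S] (f : R →+* S) (hp : HasParity n p) :
    HasParity n (p.map f) := fun k hk => hp k fun h => hk (by simp [h])

end Parity

theorem eq_expand_contract_of_even {P : ℝ[X]} (h : ∀ x, P.eval (-x) = P.eval x) :
    P = expand ℝ 2 (contract 2 P) := by
  have h1 : P.comp (-X) = P := by
    refine Polynomial.funext fun x => ?_
    simpa using h x
  ext k
  rw [coeff_expand two_pos]
  split_ifs with hk
  · rw [coeff_contract two_ne_zero, Nat.div_mul_cancel hk]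
  · have h2 : (P.comp (-X)).coeff k = (-1) ^ k * P.coeff k := by
      rw [← neg_one_mul (X : ℝ[X]), ← C_1, ← C_neg, comp_C_mul_X_coeff, mul_comm]
    rw [h1, Odd.neg_one_pow (Nat.not_even_iff_odd.1 fun h' => hk h'.two_dvd)] at h2
    linarith

/-! ### Sums of two squares on an interval -/

/-- `a(x²) = B(x)² + (1 - x²) C(x)²` with `B` of degree at most `n` and of the parity of `n`, and
`C` of degree at most `n - 1` and of the opposite parity. -/
def IsWeightedSumSq (n : ℕ) (a : ℝ[X]) : Prop :=
  ∃ B C : ℝ[X], HasParity n B ∧ HasParity n (X * C) ∧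
    expand ℝ 2 a = B ^ 2 + (1 - X ^ 2) * C ^ 2

/-- The form is the squared modulus of B + i√(1 - x²) C, which is multiplicative. -/
theorem IsWeightedSumSq.mul {m n : ℕ} {a b : ℝ[X]} (ha : IsWeightedSumSq m a)
    (hb : IsWeightedSumSq n b) : IsWeightedSumSq (m + n) (a * b) := by
  obtain ⟨B, C, hB, hC, h⟩ := ha
  obtain ⟨B', C', hB', hC', h'⟩ := hb
  refine ⟨B * B' - (1 - X ^ 2) * (C * C'), B * C' + B' * C,
    (hB.mul hB').sub (HasParity.one_sub_X_sq_mul ?_), ?_, ?_⟩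
  · have : X * (X * (C * C')) = (X * C) * (X * C') := by ring
    rw [this]; exact hC.mul hC'
  · have : X * (B * C' + B' * C) = B * (X * C') + (X * C) * B' := by ring
    rw [this]; exact (hB.mul hC').add (hC.mul hB')
  · rw [map_mul, h, h']; ring

theorem isWeightedSumSq_C {r : ℝ} (hr : 0 ≤ r) : IsWeightedSumSq 0 (C r) := by
  refine ⟨C (Real.sqrt r), 0, HasParity.C _, by simpa using HasParity.zero 0, ?_⟩
  rw [← C_pow, Real.sq_sqrt hr]; simp

theorem isWeightedSumSq_linear {p q : ℝ} (hp : 0 ≤ p) (hq : 0 ≤ q) :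
    IsWeightedSumSq 1 (C p * X + C q * (1 - X)) := by
  refine ⟨C (Real.sqrt p) * X, C (Real.sqrt q), HasParity.X.C_mul _, ?_, ?_⟩
  · rw [mul_comm]; exact HasParity.X.C_mul _
  · rw [mul_pow, ← C_pow, ← C_pow, Real.sq_sqrt hp, Real.sq_sqrt hq]
    simp; ring

theorem isWeightedSumSq_sq_sub (r : ℝ) : IsWeightedSumSq 2 ((X - C r) * (X - C r)) := by
  refine ⟨X * X - C r, 0, ?_, by simpa using HasParity.zero 2, ?_⟩
  · exact (HasParity.X.mul HasParity.X).sub (HasParity.C r).mono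
  · simp; ring

/-- With y = x², |y - z|² = (|1 - z| y - |z| (1 - y))² + K y(1 - y): the square has the right values
at y = 0 and y = 1, and comparing the coefficients of y² gives K = (|1 - z| + |z|)² - 1, nonnegative
by the triangle inequality. -/
theorem isWeightedSumSq_quadratic (z : ℂ) :
    IsWeightedSumSq 2 (X ^ 2 - C (2 * z.re) * X + C (‖z‖ ^ 2)) := by
  have hX2 : HasParity 2 (X * X : ℝ[X]) := HasParity.X.mul HasParity.X
  have h1 : 0 ≤ (‖1 - z‖ + ‖z‖) ^ 2 - 1 := by
    have : 1 ≤ ‖1 - z‖ + ‖z‖ := by simpa using norm_add_le (1 - z) z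
    nlinarith
  have h2 : ‖1 - z‖ ^ 2 = 1 - 2 * z.re + ‖z‖ ^ 2 := by
    rw [← Complex.normSq_eq_norm_sq, ← Complex.normSq_eq_norm_sq, Complex.normSq_apply,
      Complex.normSq_apply]
    simp; ring
  refine ⟨C ‖1 - z‖ * (X * X) - C ‖z‖ * (1 - X * X),
    C (Real.sqrt ((‖1 - z‖ + ‖z‖) ^ 2 - 1)) * X, ?_, ?_, ?_⟩
  · exact (hX2.C_mul _).sub (((by simpa using (HasParity.C (1 : ℝ)).mono : HasParity 2 1).sub
      hX2).C_mul _)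
  · rw [mul_left_comm]; exact hX2.C_mul _
  · rw [mul_pow (C _), ← C_pow, Real.sq_sqrt h1]
    have h3 : (2 * z.re) = 1 + ‖z‖ ^ 2 - ‖1 - z‖ ^ 2 := by linarith
    rw [h3]
    simp
    ring

theorem eval_nonneg_of_eventually {a : ℝ[X]} {r : ℝ} {s : Set ℝ} [(nhdsWithin r s).NeBot]
    (h : ∀ᶠ y in nhdsWithin r s, 0 ≤ a.eval y) : 0 ≤ a.eval r :=
  ge_of_tendsto (a.continuous.continuousAt.continuousWithinAt (s := s)) h

/-- A polynomial of degree at most `n` that is nonnegative on `(0, 1)` is a weighted sum of two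
squares (the Markov–Lukács theorem). -/
theorem isWeightedSumSq_of_nonneg (n : ℕ) : ∀ a : ℝ[X], a.natDegree ≤ n →
    (∀ y ∈ Set.Ioo (0 : ℝ) 1, 0 ≤ a.eval y) → IsWeightedSumSq n a := by
  induction n using Nat.strong_induction_on with
  | _ n ih =>
  intro a hdeg ha
  rcases Nat.eq_zero_or_pos n with rfl | hn
  · rw [eq_C_of_natDegree_le_zero hdeg] at ha ⊢
    exact isWeightedSumSq_C (by simpa using ha (1 / 2) (by norm_num))
  obtain ⟨m, rfl⟩ : ∃ m, n = m + 1 := ⟨n - 1, by omega⟩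
  by_cases hlt : a.natDegree ≤ m
  -- Multiplying by 1 = y + (1 - y) raises the level without changing the polynomial.
  · have h1 := (ih m (by omega) a hlt ha).mul
      (isWeightedSumSq_linear (zero_le_one' ℝ) (zero_le_one' ℝ))
    have h2 : a * (C 1 * X + C 1 * (1 - X)) = a := by rw [C_1]; ring
    rwa [h2] at h1
  have hd : a.natDegree = m + 1 := by omega
  have ha0 : a ≠ 0 := fun h => by simp [h] at hd
  obtain ⟨z, hz⟩ := IsAlgClosed.exists_aeval_eq_zero ℂ a
    (by rw [degree_eq_natDegree ha0, hd]; exact_mod_cast Nat.succ_ne_zero m)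
  by_cases him : z.im = 0
  · obtain ⟨r, rfl⟩ : ∃ r : ℝ, z = r := ⟨z.re, by apply Complex.ext <;> simp [him]⟩
    have hroot : a.IsRoot r := by
      have h1 : aeval ((r : ℝ) : ℂ) a = ((a.eval r : ℝ) : ℂ) := by
        have := aeval_algebraMap_apply ℂ r a
        rwa [coe_aeval_eq_eval] at this
      rw [h1] at hz
      exact_mod_cast hz
    obtain ⟨b, hb⟩ := dvd_iff_isRoot.2 hroot
    have hb0 : b ≠ 0 := fun h => ha0 (by simp [hb, h])
    have hbd : b.natDegree = m := by
      rw [hb, natDegree_mul (X_sub_C_ne_zero r) hb0, natDegree_X_sub_C] at hd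
      omega
    have hev : ∀ y, a.eval y = (y - r) * b.eval y := fun y => by simp [hb]
    -- A real root outside (0, 1) splits off a linear factor that is a nonnegative combination of y
    -- and 1 - y.
    rcases le_or_gt r 0 with hr | hr
    · have h1 := (isWeightedSumSq_linear (p := 1 - r) (q := -r) (by linarith) (by linarith)).mul
        (ih m (by omega) b hbd.le fun y hy => by
          have := ha y hy
          rw [hev] at this
          exact nonneg_of_mul_nonneg_right this (by linarith [hy.1]))
      have h2 : (C (1 - r) * X + C (-r) * (1 - X)) = X - C r := by
        simp only [C_sub, C_neg, C_1]; ring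
      rwa [h2, ← hb, add_comm] at h1
    rcases le_or_gt 1 r with hr' | hr'
    · have h1 := (isWeightedSumSq_linear (p := r - 1) (q := r) (by linarith) (by linarith)).mul
        (ih m (by omega) (-b) (by rw [natDegree_neg]; exact hbd.le) fun y hy => by
          have := ha y hy
          rw [hev] at this
          rw [eval_neg]
          refine nonneg_of_mul_nonneg_right (a := r - y) ?_ (by linarith [hy.2])
          linarith)
      have h2 : (C (r - 1) * X + C r * (1 - X)) * (-b) = a := by
        rw [hb]; simp only [C_sub, C_1]; ring
      rwa [h2, add_comm] at h1
    have hnhds : ∀ᶠ y in nhds r, y ∈ Set.Ioo (0 : ℝ) 1 := Ioo_mem_nhds hr hr'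
    -- At an interior root y - r changes sign, so the cofactor must vanish there too: the root is
    -- double.
    have hbr : b.IsRoot r := by
      apply le_antisymm
      · have h1 : 0 ≤ (-b).eval r := by
          refine eval_nonneg_of_eventually (s := Set.Iio r) ?_
          filter_upwards [nhdsWithin_le_nhds hnhds, self_mem_nhdsWithin] with y hy hyr
          have := ha y hy
          rw [hev] at this
          rw [eval_neg]
          refine nonneg_of_mul_nonneg_right (a := r - y) (by linarith) ?_
          exact sub_pos.2 hyr
        rw [eval_neg] at h1
        linarith
      · refine eval_nonneg_of_eventually (s := Set.Ioi r) ?_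
        filter_upwards [nhdsWithin_le_nhds hnhds, self_mem_nhdsWithin] with y hy hyr
        have := ha y hy
        rw [hev] at this
        exact nonneg_of_mul_nonneg_right this (sub_pos.2 hyr)
    obtain ⟨e, he⟩ := dvd_iff_isRoot.2 hbr
    have he0 : e ≠ 0 := fun h => hb0 (by simp [he, h])
    have hed : e.natDegree + 1 = m := by
      rw [he, natDegree_mul (X_sub_C_ne_zero r) he0, natDegree_X_sub_C] at hbd
      omega
    have hne : ∀ y ∈ Set.Ioo (0 : ℝ) 1, y ≠ r → 0 ≤ e.eval y := fun y hy hyr => by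
      have := ha y hy
      rw [hev, he, eval_mul, ← mul_assoc] at this
      simp only [eval_sub, eval_X, eval_C] at this
      refine nonneg_of_mul_nonneg_right this ?_
      exact mul_self_pos.2 (sub_ne_zero.2 hyr)
    have h1 := (isWeightedSumSq_sq_sub r).mul (ih e.natDegree (by omega) e le_rfl fun y hy => by
      by_cases hyr : y = r
      · subst hyr
        refine eval_nonneg_of_eventually (s := {y}ᶜ) ?_
        filter_upwards [nhdsWithin_le_nhds hnhds, self_mem_nhdsWithin] with x hx hxy
        exact hne x hx hxy
      · exact hne y hy hyr)
    rw [mul_assoc, ← he, ← hb] at h1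
    have h2 : 2 + e.natDegree = m + 1 := by omega
    rwa [h2] at h1
  · obtain ⟨b, hb⟩ := a.quadratic_dvd_of_aeval_eq_zero_im_ne_zero hz him
    have hb0 : b ≠ 0 := fun h => ha0 (by rw [hb, h, mul_zero])
    have hq : (X ^ 2 - C (2 * z.re) * X + C (‖z‖ ^ 2)).natDegree = 2 := by compute_degree!
    have hq0 : X ^ 2 - C (2 * z.re) * X + C (‖z‖ ^ 2) ≠ 0 := fun h => by
      rw [h, natDegree_zero] at hq; omega
    have hbd : 2 + b.natDegree = m + 1 := by
      rw [← hd, hb, natDegree_mul hq0 hb0, hq]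
    have h1 := (isWeightedSumSq_quadratic z).mul (ih b.natDegree (by omega) b le_rfl fun y hy => by
      have := ha y hy
      rw [hb, eval_mul] at this
      refine nonneg_of_mul_nonneg_right this ?_
      have h3 : ‖z‖ ^ 2 = z.re ^ 2 + z.im ^ 2 := by
        rw [← Complex.normSq_eq_norm_sq, Complex.normSq_apply]; ring
      simp only [eval_add, eval_sub, eval_mul, eval_pow, eval_X, eval_C, h3]
      have : 0 < z.im ^ 2 := by positivity
      nlinarith [sq_nonneg (y - z.re)])
    rwa [← hb, hbd] at h1

end

section

open Polynomial

/-! ### Quantum signal processing -/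

/-- The phase gate `e^{iφZ}`. -/
def phaseMat (φ : ℝ) : Matrix (Fin 2) (Fin 2) ℂ :=
  !![Complex.exp (Complex.I * φ), 0; 0, Complex.exp (-(Complex.I * φ))]

/-- The reflection with signal `s`. -/
def reflMat (s c : ℝ) : Matrix (Fin 2) (Fin 2) ℂ := !![(s : ℂ), (c : ℂ); (c : ℂ), -(s : ℂ)]

/-- The product `e^{iφ_d Z} W ⋯ e^{iφ_1 Z} W`, where `W` is the reflection with signal `s`. -/
def signalProd {d : ℕ} (φ : Fin d → ℝ) (s c : ℝ) : Matrix (Fin 2) (Fin 2) ℂ :=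
  (List.ofFn fun i => phaseMat (φ i) * reflMat s c).reverse.prod

theorem signalProd_snoc {d : ℕ} (φ : Fin d → ℝ) (ψ s c : ℝ) :
    signalProd (Fin.snoc φ ψ : Fin (d + 1) → ℝ) s c =
      phaseMat ψ * reflMat s c * signalProd φ s c := by
  simp only [signalProd, List.ofFn_succ_last, List.reverse_append, List.reverse_singleton,
    List.singleton_append, List.prod_cons, Fin.snoc_castSucc, Fin.snoc_last]

/-- Half the difference of the arguments is given to each side. This phase makes the leading
coefficients cancel in the peeling step. -/
theorem exists_phase_mul_eq {a b : ℂ} (h : ‖a‖ = ‖b‖) :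
    ∃ ψ : ℝ, Complex.exp (-(Complex.I * ψ)) * a = Complex.exp (Complex.I * ψ) * b := by
  refine ⟨(a.arg - b.arg) / 2, ?_⟩
  have ha := Complex.norm_mul_exp_arg_mul_I a
  have hb := Complex.norm_mul_exp_arg_mul_I b
  rw [h] at ha
  generalize a.arg = x at *
  generalize b.arg = y at *
  rw [← ha, ← hb, mul_left_comm, ← Complex.exp_add, mul_left_comm, ← Complex.exp_add, hb]
  congr 2
  push_cast
  ring

theorem coeff_two_mul_mul_map_conj {n : ℕ} {p : ℂ[X]} (hp : p.natDegree ≤ n) :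
    (p * p.map (starRingEnd ℂ)).coeff (n + n) = ((‖p.coeff n‖ ^ 2 : ℝ) : ℂ) := by
  rw [coeff_mul_add_eq_of_natDegree_le hp (natDegree_map_le.trans hp), coeff_map, Complex.mul_conj,
    Complex.normSq_eq_norm_sq]

/-- A normalized pair of polynomials of suitable parity is produced by a product of phases and
reflections. -/
theorem exists_signalProd_of_normalized (n : ℕ) : ∀ p q : ℂ[X], HasParity n p →
    HasParity n (X * q) →
    p * p.map (starRingEnd ℂ) + (1 - X ^ 2) * (q * q.map (starRingEnd ℂ)) = 1 →
    ∃ (φ₀ : ℝ) (φ : Fin n → ℝ), ∀ s c : ℝ, s ^ 2 + c ^ 2 = 1 →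
      signalProd φ s c *ᵥ ![Complex.exp (Complex.I * φ₀), 0] =
        ![p.eval (s : ℂ), (c : ℂ) * q.eval (s : ℂ)] := by
  induction n with
  | zero =>
    intro p q hp hq h
    have hq0 : q = 0 := by
      ext k
      by_contra hk
      have := (hq (k + 1) (by rwa [coeff_X_mul])).1
      omega
    have hp0 := eq_C_of_natDegree_le_zero hp.natDegree_le
    set r := p.coeff 0
    have hr : ‖r‖ = 1 := by
      have h1 := congrArg (fun f => coeff f 0) h
      simp only [hq0, zero_mul, mul_zero, add_zero] at h1
      rw [coeff_two_mul_mul_map_conj (n := 0) hp.natDegree_le, coeff_one_zero] at h1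
      have h2 : ‖r‖ ^ 2 = 1 := by exact_mod_cast h1
      nlinarith [norm_nonneg r]
    refine ⟨r.arg, Fin.elim0, fun s c _ => ?_⟩
    have h3 : Complex.exp (Complex.I * r.arg) = r := by
      have := Complex.norm_mul_exp_arg_mul_I r
      rwa [hr, Complex.ofReal_one, one_mul, mul_comm] at this
    rw [h3, hp0, hq0]
    simp [signalProd]
  | succ m ih =>
    intro p q hp hq h
    have hq' : q.natDegree ≤ m + 1 := by
      rw [natDegree_le_iff_coeff_eq_zero]
      intro k hk
      by_contra h'
      have := (hq (k + 1) (by rwa [coeff_X_mul])).1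
      omega
    have hqtop : ∀ k, m < k → q.coeff k = 0 := by
      intro k hk
      by_contra h'
      have := (hq (k + 1) (by rwa [coeff_X_mul])).1
      omega
    -- Comparison of the coefficients of degree 2(m + 1) in the normalization.
    have hnorm : ‖p.coeff (m + 1)‖ = ‖q.coeff m‖ := by
      have h1 := congrArg (fun f => coeff f (m + 1 + (m + 1))) h
      have h2 : (1 - X ^ 2) * (q * q.map (starRingEnd ℂ)) =
          q * q.map (starRingEnd ℂ) - (X * q) * (X * q).map (starRingEnd ℂ) := by
        rw [Polynomial.map_mul, map_X]; ring
      simp only [h2] at h1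
      rw [coeff_add, coeff_sub, coeff_two_mul_mul_map_conj hp.natDegree_le,
        coeff_two_mul_mul_map_conj hq', coeff_two_mul_mul_map_conj hq.natDegree_le,
        coeff_one, if_neg (by omega), coeff_X_mul, hqtop (m + 1) (by omega)] at h1
      have h3 : ‖p.coeff (m + 1)‖ ^ 2 = ‖q.coeff m‖ ^ 2 := by
        have : ‖p.coeff (m + 1)‖ ^ 2 - ‖q.coeff m‖ ^ 2 = 0 := by
          rw [norm_zero, zero_pow two_ne_zero, Complex.ofReal_zero, zero_sub] at h1
          exact_mod_cast (by rw [Complex.ofReal_sub, sub_eq_add_neg]; exact h1 :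
            ((‖p.coeff (m + 1)‖ ^ 2 - ‖q.coeff m‖ ^ 2 : ℝ) : ℂ) = 0)
        linarith
      exact (sq_eq_sq₀ (norm_nonneg _) (norm_nonneg _)).1 h3
    obtain ⟨ψ, hψ⟩ := exists_phase_mul_eq hnorm
    set e := Complex.exp (Complex.I * ψ) with he
    set e' := Complex.exp (-(Complex.I * ψ)) with he'
    have hee : e * e' = 1 := by rw [he, he', ← Complex.exp_add, add_neg_cancel, Complex.exp_zero]
    have hce : (starRingEnd ℂ) e = e' := by
      rw [he, he', ← Complex.exp_conj]; simp
    have hce' : (starRingEnd ℂ) e' = e := by rw [← hce, Complex.conj_conj]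
    have hCC : (C e * C e' : ℂ[X]) = 1 := by rw [← C_mul, hee, C_1]
    have hpar_p : HasParity (m + 2) (X * (C e' * p) + (1 - X ^ 2) * (C e * q)) := by
      have hX : X * (X * (C e * q)) = X * (C e * (X * q)) := by ring
      have h1 : HasParity (1 + (m + 1)) (X * (C e' * p) + (1 - X ^ 2) * (C e * q)) := by
        refine (HasParity.X.mul (hp.C_mul e')).add (HasParity.one_sub_X_sq_mul ?_)
        rw [hX]
        exact HasParity.X.mul (hq.C_mul e)
      rwa [show 1 + (m + 1) = m + 2 by omega] at h1
    have hpar_q : HasParity (m + 2) (X * (C e' * p - X * (C e * q))) := by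
      have hX : X * (C e * q) = C e * (X * q) := by ring
      have h1 : HasParity (1 + (m + 1)) (X * (C e' * p - X * (C e * q))) := by
        rw [hX]
        exact HasParity.X.mul ((hp.C_mul e').sub (hq.C_mul e))
      rwa [show 1 + (m + 1) = m + 2 by omega] at h1
    -- Undoing the last factor applies W e^{-iψZ} to (p, cq). Using c² = 1 - s², the result is again
    -- of the form (polynomial, c · polynomial). Its degree bound seems to rise to m + 2, but that
    -- coefficient is killed by the choice of ψ.
    obtain ⟨φ₀, φ, hφ⟩ := ih (X * (C e' * p) + (1 - X ^ 2) * (C e * q))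
      (C e' * p - X * (C e * q))
      (hpar_p.of_coeff_eq_zero (by
        have : X * (C e' * p) + (1 - X ^ 2) * (C e * q) =
          X * (C e' * p) + C e * q - X * (X * (C e * q)) := by ring
        rw [this]
        simp only [coeff_sub, coeff_add, coeff_X_mul, coeff_C_mul, hqtop (m + 2) (by omega), hψ]
        ring))
      (hpar_q.of_coeff_eq_zero (by
        simp only [coeff_sub, coeff_X_mul, coeff_C_mul, hψ]
        ring))
      (by
        simp only [Polynomial.map_add, Polynomial.map_sub, Polynomial.map_mul, Polynomial.map_pow,
          Polynomial.map_one, map_X, map_C, hce, hce']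
        linear_combination h + (p * p.map (starRingEnd ℂ) +
          (1 - X ^ 2) * (q * q.map (starRingEnd ℂ))) * hCC)
    refine ⟨φ₀, Fin.snoc φ ψ, fun s c hsc => ?_⟩
    rw [signalProd_snoc, ← Matrix.mulVec_mulVec, hφ s c hsc, ← Matrix.mulVec_mulVec]
    have hsc' : (s : ℂ) ^ 2 + (c : ℂ) ^ 2 = 1 := by exact_mod_cast hsc
    simp only [eval_add, eval_sub, eval_mul, eval_pow, eval_X, eval_C, eval_one, phaseMat, reflMat,
      ← he, ← he']
    ext i
    fin_cases i
    · simp [Matrix.mulVec, dotProduct, Fin.sum_univ_two]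
      linear_combination (eval (s : ℂ) p) * hee + (e * e' * eval (s : ℂ) p -
        s * e ^ 2 * eval (s : ℂ) q) * hsc'
    · simp [Matrix.mulVec, dotProduct, Fin.sum_univ_two]
      linear_combination (c * eval (s : ℂ) q) * hee

theorem Admissible.even_natDegree {P : ℝ[X]} (hP : Admissible P) : Even P.natDegree := by
  rw [eq_expand_contract_of_even hP.even, natDegree_expand]
  exact even_two.mul_left _

/-- The phases of an admissible polynomial. -/
theorem Admissible.exists_phases {P : ℝ[X]} (hP : Admissible P) :
    ∃ φ : Fin P.natDegree → ℝ, ∀ s c : ℝ, s ^ 2 + c ^ 2 = 1 →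
      (signalProd φ s c 0 0).re = P.eval s := by
  set a := contract 2 P
  have hPa : P = expand ℝ 2 a := eq_expand_contract_of_even hP.even
  have hd : P.natDegree = a.natDegree * 2 := by
    conv_lhs => rw [hPa]
    exact natDegree_expand 2 a
  obtain ⟨B, D, hB, hD, hBD⟩ := isWeightedSumSq_of_nonneg P.natDegree (1 - a ^ 2)
    (by
      refine (natDegree_sub_le _ _).trans ?_
      rw [natDegree_one, hd, mul_comm]
      exact max_le (Nat.zero_le _) natDegree_pow_le)
    (by
      intro y hy
      have h1 := hP.bounded (Real.sqrt y) ⟨by linarith [Real.sqrt_nonneg y],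
        Real.sqrt_le_one.2 hy.2.le⟩
      rw [hPa, expand_eval, Real.sq_sqrt hy.1.le] at h1
      simp only [eval_sub, eval_one, eval_pow]
      nlinarith [abs_le.1 h1, sq_abs (eval y a), abs_nonneg (eval y a)])
  rw [map_sub, map_one, map_pow, ← hPa] at hBD
  have hparP : HasParity P.natDegree P := by
    intro k hk
    refine ⟨le_natDegree_of_ne_zero hk, ?_⟩
    rw [hPa, coeff_expand two_pos] at hk
    have h2 : 2 ∣ k := by by_contra h; exact hk (if_neg h)
    rw [Nat.even_iff]
    omega
  have hBD' := congrArg (Polynomial.map Complex.ofRealHom) hBD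
  simp only [Polynomial.map_add, Polynomial.map_sub, Polynomial.map_mul, Polynomial.map_pow,
    Polynomial.map_one, map_X] at hBD'
  have hconj : ∀ f : ℝ[X], (f.map Complex.ofRealHom).map (starRingEnd ℂ) =
      f.map Complex.ofRealHom := by
    intro f
    ext k
    simp
  -- The completion is p = P + iB, q = iD, with B and D real, so that |p|² + (1 - x²)|q|² = 1 for
  -- real x.
  have hI : (C Complex.I * C Complex.I : ℂ[X]) = -1 := by
    rw [← C_mul, Complex.I_mul_I, C_neg, C_1]
  obtain ⟨φ₀, φ, hφ⟩ := exists_signalProd_of_normalized P.natDegree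
    (P.map Complex.ofRealHom + C Complex.I * B.map Complex.ofRealHom)
    (C Complex.I * D.map Complex.ofRealHom)
    ((hparP.map _).add ((hB.map _).C_mul _))
    (by
      have := (hD.map Complex.ofRealHom).C_mul Complex.I
      rw [Polynomial.map_mul, map_X] at this
      rwa [mul_left_comm])
    (by
      simp only [Polynomial.map_add, Polynomial.map_mul, map_C, hconj, Complex.conj_I, C_neg]
      linear_combination -hBD' - ((B.map Complex.ofRealHom) ^ 2 +
        (1 - X ^ 2) * (D.map Complex.ofRealHom) ^ 2) * hI)
  have hpos := hP.nonconst
  have hre : ∀ s c : ℝ, s ^ 2 + c ^ 2 = 1 →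
      (signalProd φ s c 0 0 * Complex.exp (Complex.I * φ₀)).re = P.eval s := by
    intro s c hsc
    have h1 := congrFun (hφ s c hsc) 0
    simp only [Matrix.mulVec, dotProduct, Fin.sum_univ_two, Matrix.cons_val_zero,
      Matrix.cons_val_one, mul_zero, add_zero] at h1
    have hev : ∀ f : ℝ[X], (f.map Complex.ofRealHom).eval (s : ℂ) = ((f.eval s : ℝ) : ℂ) := by
      intro f
      exact eval_map_apply Complex.ofRealHom s
    rw [h1, eval_add, eval_mul, eval_C, hev, hev]
    simp
  generalize P.natDegree = d at φ hre hpos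
  obtain ⟨m, rfl⟩ : ∃ m, d = m + 1 := ⟨d - 1, by omega⟩
  -- The initial phase φ₀ multiplies the (0, 0) entry, as does the last phase, which absorbs it; a
  -- last phase exists because P is non-constant.
  refine ⟨Fin.snoc (Fin.init φ) (φ (Fin.last m) + φ₀), fun s c hsc => ?_⟩
  rw [← hre s c hsc]
  conv_rhs => rw [← Fin.snoc_init_self φ]
  rw [signalProd_snoc, signalProd_snoc, mul_assoc, mul_assoc]
  have hz : ∀ (ψ : ℝ) (N : Matrix (Fin 2) (Fin 2) ℂ),
      (phaseMat ψ * N) 0 0 = Complex.exp (Complex.I * ψ) * N 0 0 := by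
    intro ψ N
    simp [phaseMat, Matrix.mul_apply, Fin.sum_univ_two]
  rw [hz, hz, Complex.ofReal_add, mul_add, Complex.exp_add]
  congr 1
  ring

/-! ### Polynomial approximation of the threshold function -/

theorem exists_admissible_approxThreshold {k μ ε δ : ℝ} (hk : 0 < k) (hk1 : k < 1) (hμ : 0 < μ)
    (hμ1 : μ < 1) (hε : 0 < ε) (hδ : 0 < δ) :
    ∃ P : ℝ[X], Admissible P ∧ ApproxThreshold P k μ ε δ := by
  set ν := μ ^ 2 with hν
  have hν0 : 0 < ν := by positivity
  have hν1 : ν < 1 := by rw [hν]; nlinarith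
  set η := min (δ * μ) 1
  have hη : 0 < η := lt_min (by positivity) one_pos
  have hη1 : η ≤ 1 := min_le_right _ _
  -- (ν - y) G(y) equals ±k/2 once |y - ν| ≥ η; adding k/2 gives the step of height k at y = ν. The
  -- cutoff η keeps G continuous.
  set G : ℝ → ℝ := fun y => k / 2 / max η |y - ν| with hG
  have hmax : ∀ y, 0 < max η |y - ν| := fun y => lt_max_of_lt_left hη
  have hGc : Continuous G := by
    refine continuous_const.div (by fun_prop) fun y => (hmax y).ne'
  -- The three bounds serve the accuracy, the bound P ≤ 1, and the positivity of `g` together with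
  -- the error k/2 near the jump.
  set τ := min (min ε (1 - k)) (k / 2) with hτ
  have hτ0 : 0 < τ := lt_min (lt_min hε (by linarith)) (by linarith)
  have hτε : τ ≤ ε := (min_le_left _ _).trans (min_le_left _ _)
  have hτ1 : τ ≤ 1 - k := (min_le_left _ _).trans (min_le_right _ _)
  have hτk : τ ≤ k / 2 := min_le_right _ _
  obtain ⟨g, hg⟩ := exists_polynomial_near_of_continuousOn 0 1 G hGc.continuousOn τ hτ0
  set P : ℝ[X] := C (k / 2) + (C ν - X ^ 2) * expand ℝ 2 g with hP
  have hev : ∀ x, P.eval x = k / 2 + (ν - x ^ 2) * g.eval (x ^ 2) := fun x => by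
    simp [hP, expand_eval]
  have habs : ∀ y ∈ Set.Icc (0 : ℝ) 1, |y - ν| ≤ 1 := fun y hy => by
    rw [abs_le]; constructor <;> linarith [hy.1, hy.2]
  have hgpos : ∀ y ∈ Set.Icc (0 : ℝ) 1, 0 < g.eval y := fun y hy => by
    have h1 : k / 2 ≤ G y := by
      rw [hG]
      exact le_div_self (by linarith) (hmax y) (max_le hη1 (habs y hy))
    have := (abs_lt.1 (hg y hy)).1
    linarith
  have hclose : ∀ y ∈ Set.Icc (0 : ℝ) 1, |y - ν| * g.eval y < k / 2 + τ := fun y hy => by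
    have h1 : |y - ν| * G y ≤ k / 2 := by
      rw [hG, ← mul_div_assoc, div_le_iff₀ (hmax y), mul_comm]
      exact mul_le_mul_of_nonneg_left (le_max_right _ _) (by linarith)
    have h2 := (abs_lt.1 (hg y hy)).2
    have h3 := habs y hy
    rcases eq_or_lt_of_le (abs_nonneg (y - ν)) with h0 | h0
    · rw [← h0]; linarith
    · nlinarith
  have hfar : ∀ y ∈ Set.Icc (0 : ℝ) 1, η < |y - ν| → k / 2 - τ < |y - ν| * g.eval y :=
    fun y hy hfar => by
      have h1 : |y - ν| * G y = k / 2 := by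
        rw [hG]
        simp only [max_eq_right hfar.le]
        field_simp [(hη.trans hfar).ne']
      have h2 := (abs_lt.1 (hg y hy)).1
      have h3 := habs y hy
      nlinarith [hη.trans hfar]
  have hsq : ∀ x ∈ Set.Icc (-1 : ℝ) 1, x ^ 2 ∈ Set.Icc (0 : ℝ) 1 := fun x hx =>
    ⟨sq_nonneg x, by nlinarith [hx.1, hx.2]⟩
  have hin : ∀ x, |x| ≤ μ → |x ^ 2 - ν| = ν - x ^ 2 := fun x hx => by
    rw [abs_of_nonpos]; · ring
    rw [hν, sub_nonpos, sq_le_sq, abs_of_pos hμ]; exact hx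
  have hout : ∀ x, ¬ |x| ≤ μ → |x ^ 2 - ν| = x ^ 2 - ν := fun x hx => by
    rw [abs_of_nonneg]
    rw [hν, sub_nonneg, sq_le_sq, abs_of_pos hμ]; exact (not_le.1 hx).le
  refine ⟨P, ⟨fun x => by rw [hev, hev, neg_sq], ?_, fun x hx => ?_⟩, fun x hx hx' => ?_,
    fun x hx _ => ?_⟩
  -- P(μ) = k/2, whereas P(0) > k/2 because `g` is positive.
  · rw [Nat.pos_iff_ne_zero]
    intro h0
    have h1 := eq_C_of_natDegree_eq_zero h0
    have h2 : P.eval 0 = P.eval μ := by rw [h1]; simp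
    rw [hev, hev, ← hν] at h2
    have := hgpos 0 (by simp)
    norm_num at h2
    rcases h2 with h2 | h2 <;> linarith
  · have h1 := hclose _ (hsq x hx)
    have h2 := hgpos _ (hsq x hx)
    rw [hev, abs_le]
    by_cases hxμ : |x| ≤ μ
    · have h3 := hin x hxμ
      have h4 : 0 ≤ |x ^ 2 - ν| * g.eval (x ^ 2) := by positivity
      rw [h3] at h1 h4
      constructor <;> linarith
    · have h3 := hout x hxμ
      have h4 : 0 ≤ |x ^ 2 - ν| * g.eval (x ^ 2) := by positivity
      rw [h3] at h1 h4
      constructor <;> linarith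
  · have h0 : η < |x ^ 2 - ν| := by
      have h1 : x ^ 2 - ν = (|x| - μ) * (|x| + μ) := by rw [hν, ← sq_abs x]; ring
      rw [h1, abs_mul, abs_of_pos (by positivity : 0 < |x| + μ)]
      calc η ≤ δ * μ := min_le_left _ _
        _ < abs (|x| - μ) * μ := by gcongr
        _ ≤ _ := by gcongr; linarith [abs_nonneg x]
    have h1 := hclose _ (hsq x hx)
    have h2 := hfar _ (hsq x hx) h0
    rw [hev, threshold, abs_lt]
    by_cases hxμ : |x| ≤ μ
    · rw [hin x hxμ] at h1 h2
      rw [if_pos hxμ]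
      constructor <;> linarith
    · rw [hout x hxμ] at h1 h2
      rw [if_neg hxμ]
      constructor <;> linarith
  · have h1 := hclose _ (hsq x hx)
    have h2 := hgpos _ (hsq x hx)
    rw [hev, threshold, abs_le]
    by_cases hxμ : |x| ≤ μ
    · have h3 := hin x hxμ
      have h4 : 0 ≤ |x ^ 2 - ν| * g.eval (x ^ 2) := by positivity
      rw [h3] at h1 h4
      rw [if_pos hxμ]
      constructor <;> linarith
    · have h3 := hout x hxμ
      have h4 : 0 ≤ |x ^ 2 - ν| * g.eval (x ^ 2) := by positivity
      rw [h3] at h1 h4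
      rw [if_neg hxμ]
      constructor <;> linarith

end

/-! ### Operators on the qubit `T` controlled by the registers `C` and `B` -/

section Blocks

variable {n : ℕ}

/-- A basis label split into its parts on `T`, `C` and `B`. -/
def labelEquiv (n : ℕ) : (QWire n → Fin 2) ≃ Fin 2 × ((Fin n → Fin 2) × Fin 2) where
  toFun r := (r (tWire n), (fun i => r (cWire i), r (bWire n)))
  invFun x := label x.2.1 x.1 x.2.2
  left_inv r := by
    funext w
    rcases w with i | i
    · rfl
    · fin_cases i <;> rfl
  right_inv x := rfl

theorem exists_eq_label (r : QWire n → Fin 2) : ∃ j t b, r = label j t b :=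
  ⟨_, _, _, ((labelEquiv n).left_inv r).symm⟩

theorem sum_label {M : Type*} [AddCommMonoid M] (f : (QWire n → Fin 2) → M) :
    ∑ r, f r = ∑ j : Fin n → Fin 2, ∑ t : Fin 2, ∑ b : Fin 2, f (label j t b) := by
  rw [← (labelEquiv n).symm.sum_comp, Fintype.sum_prod_type, Finset.sum_comm,
    Fintype.sum_prod_type]
  refine Finset.sum_congr rfl fun j _ => ?_
  rw [Finset.sum_comm]
  rfl

theorem label_inj {j j' : Fin n → Fin 2} {t t' b b' : Fin 2} :
    label j t b = label j' t' b' ↔ j = j' ∧ t = t' ∧ b = b' := by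
  constructor
  · intro h
    have h' := (labelEquiv n).symm.injective
      (a₁ := (t, (j, b))) (a₂ := (t', (j', b'))) h
    simp only [Prod.mk.injEq] at h'
    tauto
  · rintro ⟨rfl, rfl, rfl⟩; rfl

theorem label_agree_off_t {j j' : Fin n → Fin 2} {t t' b b' : Fin 2} :
    (∀ w, w ≠ tWire n → label j t b w = label j' t' b' w) ↔ j = j' ∧ b = b' := by
  constructor
  · intro h
    exact ⟨funext fun i => h (cWire i) (by simp), h (bWire n) (by simp)⟩
  · rintro ⟨rfl, rfl⟩ (i | i) hw
    · rfl
    · fin_cases i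
      · exact absurd rfl hw
      · rfl

theorem label_agree_off_b {j j' : Fin n → Fin 2} {t t' b b' : Fin 2} :
    (∀ w, w ≠ bWire n → label j t b w = label j' t' b' w) ↔ j = j' ∧ t = t' := by
  constructor
  · intro h
    exact ⟨funext fun i => h (cWire i) (by simp), h (tWire n) (by simp)⟩
  · rintro ⟨rfl, rfl⟩ (i | i) hw
    · rfl
    · fin_cases i
      · rfl
      · exact absurd rfl hw

/-- The operator that applies the matrix `m (j, b)` to `T` when `C` and `B` are in the basis states
`j` and `b`. -/
def tBlock (m : (Fin n → Fin 2) × Fin 2 → Matrix (Fin 2) (Fin 2) ℂ) :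
    Matrix (QWire n → Fin 2) (QWire n → Fin 2) ℂ :=
  (Matrix.blockDiagonal m).submatrix (labelEquiv n) (labelEquiv n)

variable (m m' : (Fin n → Fin 2) × Fin 2 → Matrix (Fin 2) (Fin 2) ℂ)

theorem tBlock_label (j j' : Fin n → Fin 2) (t t' b b' : Fin 2) :
    tBlock m (label j t b) (label j' t' b') = if j = j' ∧ b = b' then m (j, b) t t' else 0 := by
  have h : ∀ j t b, labelEquiv n (label j t b) = (t, (j, b)) := fun _ _ _ => rfl
  simp [tBlock, h, Matrix.blockDiagonal_apply]

theorem tBlock_mul : tBlock m * tBlock m' = tBlock fun x => m x * m' x := by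
  rw [tBlock, tBlock, Matrix.submatrix_mul_equiv, ← Matrix.blockDiagonal_mul, tBlock]

theorem tBlock_one : tBlock (fun _ : (Fin n → Fin 2) × Fin 2 => 1) = 1 := by
  rw [tBlock]
  exact (congrArg (fun M => Matrix.submatrix M (labelEquiv n) (labelEquiv n))
    Matrix.blockDiagonal_one).trans (Matrix.submatrix_one_equiv _)

theorem tBlock_conjTranspose : (tBlock m)ᴴ = tBlock fun x => (m x)ᴴ := by
  rw [tBlock, Matrix.conjTranspose_submatrix, Matrix.blockDiagonal_conjTranspose, tBlock]

theorem tBlock_list_prod {ι : Type*} (L : List ι)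
    (f : ι → (Fin n → Fin 2) × Fin 2 → Matrix (Fin 2) (Fin 2) ℂ) :
    (L.map fun i => tBlock (f i)).prod = tBlock fun x => (L.map fun i => f i x).prod := by
  induction L with
  | nil => simp [tBlock_one]
  | cons i L ih => simp [ih, tBlock_mul]

theorem eq_of_mulVec_ket {M N : Matrix (QWire n → Fin 2) (QWire n → Fin 2) ℂ}
    (h : ∀ j t b, M *ᵥ ket j t b = N *ᵥ ket j t b) : M = N := by
  ext r s
  obtain ⟨j, t, b, rfl⟩ := exists_eq_label s
  have := congrFun (h j t b) r
  simpa [ket, Matrix.mulVec_single_one] using this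

theorem ket_label (j j' : Fin n → Fin 2) (t t' b b' : Fin 2) :
    ket j t b (label j' t' b') = if j = j' ∧ t = t' ∧ b = b' then 1 else 0 := by
  have : label j' t' b' = label j t b ↔ j = j' ∧ t = t' ∧ b = b' := by
    rw [eq_comm, label_inj]
  simp only [ket, Pi.single_apply, this]

theorem tBlock_mulVec_ket (j : Fin n → Fin 2) (t b : Fin 2) :
    tBlock m *ᵥ ket j t b = ∑ t', m (j, b) t' t • ket j t' b := by
  funext r
  obtain ⟨j', t', b', rfl⟩ := exists_eq_label r
  have h1 : (tBlock m *ᵥ ket j t b) (label j' t' b') = tBlock m (label j' t' b') (label j t b) := by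
    simp [ket]
  rw [h1, tBlock_label, Finset.sum_apply]
  simp only [Pi.smul_apply, ket_label, smul_eq_mul]
  by_cases h : j = j' ∧ b = b'
  · obtain ⟨rfl, rfl⟩ := h
    simp
  · rw [if_neg (by tauto)]
    symm
    exact Finset.sum_eq_zero fun x _ => by rw [if_neg (by tauto), mul_zero]

theorem onWire_b_mulVec_ket (u : Matrix (Fin 2) (Fin 2) ℂ) (j : Fin n → Fin 2) (t b : Fin 2) :
    onWire u (bWire n) *ᵥ ket j t b = ∑ b', u b' b • ket j t b' := by
  funext r
  obtain ⟨j', t', b', rfl⟩ := exists_eq_label r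
  have h1 : (onWire u (bWire n) *ᵥ ket j t b) (label j' t' b') =
      onWire u (bWire n) (label j' t' b') (label j t b) := by
    simp [ket]
  rw [h1, onWire, Matrix.of_apply, Finset.sum_apply]
  simp only [Pi.smul_apply, ket_label, smul_eq_mul, label_agree_off_b]
  by_cases h : j = j' ∧ t = t'
  · obtain ⟨rfl, rfl⟩ := h
    simp [label]
  · rw [if_neg (by tauto)]
    symm
    exact Finset.sum_eq_zero fun x _ => by rw [if_neg (by tauto), mul_zero]

theorem wireProj_mulVec_ket (w : QWire n) (v : Fin 2) (j : Fin n → Fin 2) (t b : Fin 2) :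
    wireProj w v *ᵥ ket j t b = if label j t b w = v then ket j t b else 0 := by
  rw [wireProj, ket, Matrix.diagonal_mulVec_single, mul_one]
  split_ifs <;> simp

theorem onWire_t (u : Matrix (Fin 2) (Fin 2) ℂ) : onWire u (tWire n) = tBlock fun _ => u := by
  ext r s
  obtain ⟨j, t, b, rfl⟩ := exists_eq_label r
  obtain ⟨j', t', b', rfl⟩ := exists_eq_label s
  rw [tBlock_label, onWire, Matrix.of_apply]
  simp only [label_agree_off_t]
  rfl

theorem toMatrix_ctrl_cWire (i : Fin n) (u : OneQubit) (h : cWire i ≠ tWire n) :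
    (Gate.ctrl (cWire i) 1 u (tWire n) h).toMatrix =
      tBlock fun x => if x.1 i = 1 then u.toMatrix else 1 := by
  rw [Gate.toMatrix, onWire_t, ← tBlock_one]
  ext r s
  obtain ⟨j, t, b, rfl⟩ := exists_eq_label r
  obtain ⟨j', t', b', rfl⟩ := exists_eq_label s
  simp only [Matrix.of_apply, tBlock_label]
  by_cases hj : j = j' ∧ b = b'
  · obtain ⟨rfl, rfl⟩ := hj
    have : label j t' b (cWire i) = j i := rfl
    rw [this]
    split_ifs <;> simp_all
  · simp [hj]

/-! ### The amplitude-loading operator -/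

theorem toMatrix_ry_mul (a b : ℝ) :
    (OneQubit.ry a).toMatrix * (OneQubit.ry b).toMatrix = (OneQubit.ry (a + b)).toMatrix := by
  simp only [OneQubit.toMatrix, add_div, Real.cos_add, Real.sin_add]
  ext i j
  fin_cases i <;> fin_cases j <;>
    simp [Matrix.mul_apply, Fin.sum_univ_two] <;> ring

theorem toMatrix_ry_zero : (OneQubit.ry 0).toMatrix = 1 := by
  simp [OneQubit.toMatrix, Matrix.one_fin_two]

theorem toMatrix_map_ctrl (a : Fin n → ℝ) (L : List (Fin n)) :
    Circuit.toMatrix (L.map fun i : Fin n =>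
      Gate.ctrl (cWire i) 1 (.ry (a i)) (tWire n) (by simp)) =
      tBlock fun x =>
        (OneQubit.ry (L.map fun i => (((x.1 i : Fin 2) : ℕ) : ℝ) * a i).sum).toMatrix := by
  induction L with
  | nil => simp [Circuit.toMatrix, toMatrix_ry_zero, tBlock_one]
  | cons i L ih =>
    simp only [List.map_cons, Circuit.toMatrix, ih, toMatrix_ctrl_cWire, tBlock_mul,
      List.sum_cons]
    congr 1
    funext x
    rw [add_comm, ← toMatrix_ry_mul]
    congr 1
    rcases Fin.exists_fin_two.1 ⟨x.1 i, rfl⟩ with h | h <;> simp [h, toMatrix_ry_zero]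

/-- The angles selected by `j` add up, and additivity of θ collects them into θ(L_j). -/
theorem loadOp_eq_tBlock (l : Fin n → ℝ) (θ : ℝ →+ ℝ) (θ₀ : ℝ) :
    loadOp l θ θ₀ = tBlock fun x => (OneQubit.ry (2 * angle l θ θ₀ x.1)).toMatrix := by
  rw [loadOp, loadCircuit, Circuit.toMatrix, List.ofFn_eq_map,
    toMatrix_map_ctrl (fun i => 2 * θ (l i)), Gate.toMatrix, onWire_t, tBlock_mul]
  congr 1
  funext x
  rw [toMatrix_ry_mul]
  congr 2
  rw [angle, totalLoss, map_sum, mul_add, add_comm, Finset.mul_sum, ← List.ofFn_eq_map,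
    List.sum_ofFn]
  congr 1
  refine Finset.sum_congr rfl fun i _ => ?_
  -- θ is only additive, so the indicator has to be moved through it as a natural multiple.
  rw [← nsmul_eq_mul _ (l i), map_nsmul, nsmul_eq_mul]
  ring

theorem loadOp_mulVec_ket (l : Fin n → ℝ) (θ : ℝ →+ ℝ) (θ₀ : ℝ) (j : Fin n → Fin 2) (b : Fin 2) :
    loadOp l θ θ₀ *ᵥ ket j 0 b =
      ((Real.cos (θ₀ + θ (totalLoss l j)) : ℝ) : ℂ) • ket j 0 b +
      ((Real.sin (θ₀ + θ (totalLoss l j)) : ℝ) : ℂ) • ket j 1 b := by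
  rw [loadOp_eq_tBlock, tBlock_mulVec_ket, Fin.sum_univ_two]
  simp [OneQubit.toMatrix, angle]

theorem ketbra_ket_mulVec_ket (j j' j'' : Fin n → Fin 2) (t t' t'' b b' b'' : Fin 2) :
    ketbra (ket j t b) (ket j' t' b') *ᵥ ket j'' t'' b'' =
      if j' = j'' ∧ t' = t'' ∧ b' = b'' then ket j t b else 0 := by
  have h : ketbra (ket j t b) (ket j' t' b') *ᵥ ket j'' t'' b'' =
      star (ket j' t' b' (label j'' t'' b'')) • ket j t b := by
    funext r
    rw [ketbra, ket.eq_def j'' t'' b'', Matrix.mulVec_single_one, Matrix.col_apply,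
      Matrix.vecMulVec_apply, Pi.star_apply, Pi.smul_apply, smul_eq_mul, mul_comm]
  rw [h, ket_label]
  split_ifs <;> simp

theorem wireProj_mul_loadOp_mul_wireProj (l : Fin n → ℝ) (θ : ℝ →+ ℝ) (θ₀ : ℝ) :
    wireProj (tWire n) 1 * loadOp l θ θ₀ * wireProj (tWire n) 0 =
      ∑ j : Fin n → Fin 2, ∑ b : Fin 2,
        ((Real.sin (θ₀ + θ (totalLoss l j)) : ℝ) : ℂ) • ketbra (ket j 1 b) (ket j 0 b) := by
  refine eq_of_mulVec_ket fun j t b => ?_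
  have ht : ∀ j t b, label j t b (tWire n) = t := fun _ _ _ => rfl
  rw [← Matrix.mulVec_mulVec, ← Matrix.mulVec_mulVec, wireProj_mulVec_ket, ht]
  simp only [Matrix.sum_mulVec, Matrix.smul_mulVec, ketbra_ket_mulVec_ket]
  rcases Fin.exists_fin_two.1 ⟨t, rfl⟩ with rfl | rfl
  · rw [if_pos rfl, loadOp_mulVec_ket, Matrix.mulVec_add, Matrix.mulVec_smul, Matrix.mulVec_smul,
      wireProj_mulVec_ket, wireProj_mulVec_ket, ht, ht, Finset.sum_eq_single j,
      Finset.sum_eq_single b]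
    · simp
    · intro x _ hx; simp [hx]
    · simp
    · intro x _ hx; simp [hx]
    · simp
  · simp

/-! ### The singular value transformation -/

theorem projCtrlX_mulVec_ket (v : Fin 2) (j : Fin n → Fin 2) (t b : Fin 2) :
    projCtrlX (bWire n) (wireProj (tWire n) v) *ᵥ ket j t b =
      ket j t (if t = v then b + 1 else b) := by
  have ht : ∀ j t b, label j t b (tWire n) = t := fun _ _ _ => rfl
  have hx : onWire OneQubit.x.toMatrix (bWire n) *ᵥ ket j t b = ket j t (b + 1) := by
    rw [onWire_b_mulVec_ket, Fin.sum_univ_two]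
    fin_cases b <;> simp [OneQubit.toMatrix]
  rw [projCtrlX, Matrix.add_mulVec, ← Matrix.mulVec_mulVec, hx, Matrix.sub_mulVec,
    Matrix.one_mulVec, wireProj_mulVec_ket, wireProj_mulVec_ket, ht, ht]
  split_ifs <;> simp

/-- The second NOT undoes the first, so only a phase remains; its sign depends on whether T has the
value `v` and on the value of B. -/
theorem phaseOp_eq_tBlock (v : Fin 2) (φ : ℝ) :
    phaseOp (bWire n) (wireProj (tWire n) v) φ =
      tBlock fun x => phaseMat (if x.2 = v then φ else -φ) := by
  refine eq_of_mulVec_ket fun j t b => ?_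
  have hz : ∀ b, onWire (OneQubit.rz (2 * φ)).toMatrix (bWire n) *ᵥ ket j t b =
      (OneQubit.rz (2 * φ)).toMatrix b b • ket j t b := by
    intro b
    rw [onWire_b_mulVec_ket, Fin.sum_univ_two]
    fin_cases b <;> simp [OneQubit.toMatrix]
  rw [phaseOp, ← Matrix.mulVec_mulVec, ← Matrix.mulVec_mulVec, projCtrlX_mulVec_ket, hz,
    Matrix.mulVec_smul, projCtrlX_mulVec_ket, tBlock_mulVec_ket, Fin.sum_univ_two]
  fin_cases t <;> fin_cases v <;> fin_cases b <;> simp [phaseMat, OneQubit.toMatrix]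

/-- The matrix by which `Q_d ⋯ Q_1` acts on `T`, for the state `0` of `B`. -/
def alternatingProd {d : ℕ} (φ : Fin d → ℝ) (a : ℝ) : Matrix (Fin 2) (Fin 2) ℂ :=
  (List.ofFn fun i : Fin d =>
    if Even (i : ℕ) then phaseMat (φ i) * (OneQubit.ry (2 * a)).toMatrix
    else phaseMat (-φ i) * ((OneQubit.ry (2 * a)).toMatrix)ᴴ).reverse.prod

/-- X R_y(2a) is the reflection W, and X e^{iφZ} X = e^{-iφZ}. Hence the factors for -φ are
alternately X e^{iφZ} W and e^{iφZ} W X, and neighbouring X's cancel. -/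
theorem alternatingProd_neg {d : ℕ} (φ : Fin d → ℝ) (a : ℝ) :
    alternatingProd (-φ) a = OneQubit.x.toMatrix ^ d *
      signalProd φ (Real.sin a) (Real.cos a) := by
  induction d with
  | zero => simp [alternatingProd, signalProd]
  | succ d ih =>
    have h := ih (Fin.init φ)
    have h1 : alternatingProd (-φ) a = (if Even d then
        phaseMat (-φ (Fin.last d)) * (OneQubit.ry (2 * a)).toMatrix
        else phaseMat (φ (Fin.last d)) * ((OneQubit.ry (2 * a)).toMatrix)ᴴ) *
        alternatingProd (-Fin.init φ) a := by
      simp only [alternatingProd, List.ofFn_succ_last, List.reverse_append,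
        List.reverse_singleton, List.singleton_append, List.prod_cons, Fin.val_last,
        Fin.val_castSucc, Pi.neg_apply, neg_neg]
      rfl
    have h2 : signalProd φ (Real.sin a) (Real.cos a) = phaseMat (φ (Fin.last d)) *
        reflMat (Real.sin a) (Real.cos a) * signalProd (Fin.init φ) (Real.sin a) (Real.cos a) := by
      conv_lhs => rw [← Fin.snoc_init_self φ]
      exact signalProd_snoc _ _ _ _
    have hxx : OneQubit.x.toMatrix * OneQubit.x.toMatrix = 1 := by
      simp [OneQubit.toMatrix, Matrix.one_fin_two]
    rw [h1, h2, h]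
    split_ifs with hd
    · obtain ⟨k, rfl⟩ := hd
      have h3 : OneQubit.x.toMatrix ^ (k + k) = 1 := by
        rw [← two_mul, pow_mul, pow_two, hxx, one_pow]
      rw [pow_succ, h3, one_mul, one_mul, ← mul_assoc]
      congr 1
      ext i j
      fin_cases i <;> fin_cases j <;>
        simp [phaseMat, reflMat, OneQubit.toMatrix, Matrix.mul_apply, Fin.sum_univ_two]
    · obtain ⟨k, rfl⟩ := Nat.not_even_iff_odd.1 hd
      have h3 : OneQubit.x.toMatrix ^ (2 * k) = 1 := by
        rw [pow_mul, pow_two, hxx, one_pow]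
      rw [pow_succ _ (2 * k + 1), pow_succ, h3, one_mul, hxx, one_mul, ← mul_assoc]
      rw [← OneQubit.toMatrix_dagger, OneQubit.dagger]
      congr 1
      ext i j
      fin_cases i <;> fin_cases j <;>
        simp [phaseMat, reflMat, OneQubit.toMatrix, Matrix.mul_apply, Fin.sum_univ_two, neg_div]

/-- The reflections are real, so only the phases are affected by conjugation. -/
theorem signalProd_neg {d : ℕ} (φ : Fin d → ℝ) (s c : ℝ) :
    signalProd (-φ) s c = (signalProd φ s c).map (starRingEnd ℂ) := by
  have : ∀ M : Matrix (Fin 2) (Fin 2) ℂ, M.map (starRingEnd ℂ) = (starRingEnd ℂ).mapMatrix M :=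
    fun _ => rfl
  rw [this, signalProd, signalProd, map_list_prod, List.map_reverse, List.map_ofFn]
  congr 3
  funext i
  simp only [Function.comp, map_mul]
  congr 1
  · ext i j
    fin_cases i <;> fin_cases j <;> simp [phaseMat, ← Complex.exp_conj]
  · ext i j
    fin_cases i <;> fin_cases j <;> simp [reflMat]

theorem qOp_eq (l : Fin n → ℝ) (θ : ℝ →+ ℝ) (θ₀ : ℝ) {d : ℕ} (Φ : Fin d → ℝ) :
    qOp l θ θ₀ Φ = onWire OneQubit.h.toMatrix (bWire n) *
      tBlock (fun x => alternatingProd (if x.2 = 0 then Φ else -Φ) (angle l θ θ₀ x.1)) *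
      onWire OneQubit.h.toMatrix (bWire n) := by
  rw [qOp, qsvtOperator, loadOp_eq_tBlock, tBlock_conjTranspose]
  congr 2
  simp only [phaseOp_eq_tBlock, tBlock_mul, alternatingProd, List.ofFn_eq_map, ← List.map_reverse]
  rw [← tBlock_list_prod]
  congr 2
  funext i
  split_ifs
  · congr 1
    funext x
    split_ifs <;> rfl
  · congr 1
    funext x
    rcases Fin.exists_fin_two.1 ⟨x.2, rfl⟩ with h | h <;> simp [h]

/-- The Hadamards average the (0, 0) entries for φ and -φ, which are conjugate; evenness of `d`
removes X^d. -/
theorem qOp_label_zero (l : Fin n → ℝ) (θ : ℝ →+ ℝ) (θ₀ : ℝ) {d : ℕ} (φ : Fin d → ℝ)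
    (hd : Even d) (j j' : Fin n → Fin 2) :
    qOp l θ θ₀ (-φ) (label j 0 0) (label j' 0 0) = if j = j' then
      (((signalProd φ (Real.sin (angle l θ θ₀ j)) (Real.cos (angle l θ θ₀ j)) 0 0).re : ℝ) : ℂ)
      else 0 := by
  have hxd : OneQubit.x.toMatrix ^ d = 1 := by
    obtain ⟨k, rfl⟩ := hd
    have hxx : OneQubit.x.toMatrix * OneQubit.x.toMatrix = 1 := by
      simp [OneQubit.toMatrix, Matrix.one_fin_two]
    rw [← two_mul, pow_mul, pow_two, hxx, one_pow]
  have h1 : qOp l θ θ₀ (-φ) (label j 0 0) (label j' 0 0) =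
      (qOp l θ θ₀ (-φ) *ᵥ ket j' 0 0) (label j 0 0) := by
    simp [ket]
  have hs : ((((Real.sqrt 2)⁻¹ : ℝ) : ℂ)) * (((Real.sqrt 2)⁻¹ : ℝ) : ℂ) = 1 / 2 := by
    rw [← Complex.ofReal_mul, ← mul_inv, Real.mul_self_sqrt (by norm_num)]
    simp
  rw [h1, qOp_eq, ← Matrix.mulVec_mulVec, ← Matrix.mulVec_mulVec]
  simp only [onWire_b_mulVec_ket, Fin.sum_univ_two, Matrix.mulVec_add, Matrix.mulVec_smul,
    tBlock_mulVec_ket, Pi.add_apply, Pi.smul_apply, ket_label]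
  by_cases hj : j' = j
  · subst hj
    have h2 := alternatingProd_neg φ (angle l θ θ₀ j')
    have h3 := alternatingProd_neg (-φ) (angle l θ θ₀ j')
    rw [hxd, one_mul] at h2 h3
    rw [neg_neg, signalProd_neg] at h3
    simp only [neg_neg, if_true, one_ne_zero, if_false, h2, h3, Matrix.map_apply]
    generalize signalProd φ (Real.sin (angle l θ θ₀ j')) (Real.cos (angle l θ θ₀ j')) = N
    have h4 := Complex.add_conj (N 0 0)
    rw [Complex.ofReal_mul, Complex.ofReal_ofNat] at h4
    simp only [OneQubit.toMatrix, Matrix.smul_apply, Matrix.of_apply, Matrix.cons_val_zero,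
      Matrix.cons_val_one, smul_eq_mul, and_true, and_false, if_true, if_false,
      mul_one, mul_zero, add_zero, Matrix.cons_val',
      Matrix.cons_val_fin_one]
    linear_combination (N 0 0 + (starRingEnd ℂ) (N 0 0)) * hs + h4 / 2
  · simp [hj, Ne.symm hj]

end Blocks

/-! ### The full circuit -/

section Full

variable {n : ℕ}

theorem proj_mul_qOp_mul_proj {l : Fin n → ℝ} {θ : ℝ →+ ℝ} {θ₀ : ℝ} {d : ℕ} {Φ : Fin d → ℝ}
    {f : (Fin n → Fin 2) → ℝ}
    (h : ∀ j j', qOp l θ θ₀ Φ (label j 0 0) (label j' 0 0) =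
      if j = j' then ((f j : ℝ) : ℂ) else 0) :
    wireProj (bWire n) 0 * wireProj (tWire n) 0 * qOp l θ θ₀ Φ *
        wireProj (tWire n) 0 * wireProj (bWire n) 0 =
      ∑ j : Fin n → Fin 2, ((f j : ℝ) : ℂ) • ketbra (ket j 0 0) (ket j 0 0) := by
  have ht : ∀ (j : Fin n → Fin 2) t b, label j t b (tWire n) = t := fun _ _ _ => rfl
  have hb : ∀ (j : Fin n → Fin 2) t b, label j t b (bWire n) = b := fun _ _ _ => rfl
  ext r s
  obtain ⟨j, t, b, rfl⟩ := exists_eq_label r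
  obtain ⟨j', t', b', rfl⟩ := exists_eq_label s
  simp only [wireProj, Matrix.diagonal_mul, Matrix.mul_diagonal, Matrix.diagonal_mul_diagonal,
    ht, hb, Matrix.sum_apply, Matrix.smul_apply, ketbra, Matrix.vecMulVec_apply, Pi.star_apply,
    ket_label]
  by_cases h0 : (t = 0 ∧ b = 0) ∧ t' = 0 ∧ b' = 0
  · obtain ⟨⟨rfl, rfl⟩, rfl, rfl⟩ := h0
    rw [h, Finset.sum_eq_single j]
    · by_cases hj : j = j' <;> simp [hj]
    · intro x _ hx; simp [hx]
    · simp
  · rw [Finset.sum_eq_zero]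
    · by_cases h1 : t = 0 <;> by_cases h2 : b = 0 <;> by_cases h3 : t' = 0 <;>
        by_cases h4 : b' = 0 <;> simp_all
    · intro x _
      by_cases h1 : t = 0 <;> by_cases h2 : b = 0 <;> by_cases h3 : t' = 0 <;>
        by_cases h4 : b' = 0 <;> simp_all [eq_comm]

variable {z : ℕ}
  {U : Matrix ((Fin z → Fin 2) × (Fin n → Fin 2)) ((Fin z → Fin 2) × (Fin n → Fin 2)) ℂ}
  {p : PMF (Fin n → Fin 2)} {ψ : (Fin n → Fin 2) → (Fin z → Fin 2) → ℂ}
  {Q : Matrix (QWire n → Fin 2) (QWire n → Fin 2) ℂ} {f : (Fin n → Fin 2) → ℝ}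

theorem extendU_mulVec_zero (hU : LoadsScenarios U p ψ) (a : Fin z → Fin 2) (j : Fin n → Fin 2)
    (t b : Fin 2) :
    (extendU U *ᵥ Pi.single (0, 0) 1) (a, label j t b) =
      if t = 0 ∧ b = 0 then ((Real.sqrt (p j).toReal : ℝ) : ℂ) * ψ j a else 0 := by
  rw [← hU.apply_zero a j, Matrix.mulVec_single_one, Matrix.mulVec_single_one]
  rfl

theorem finalState_label_zero (hU : LoadsScenarios U p ψ)
    (h : ∀ j j', Q (label j 0 0) (label j' 0 0) = if j = j' then ((f j : ℝ) : ℂ) else 0)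
    (a : Fin z → Fin 2) (j : Fin n → Fin 2) :
    finalState U Q (a, label j 0 0) = ((f j * Real.sqrt (p j).toReal : ℝ) : ℂ) * ψ j a := by
  rw [finalState, Matrix.mulVec, dotProduct, Fintype.sum_prod_type, Finset.sum_eq_single a]
  · rw [sum_label, Finset.sum_eq_single j]
    · simp [Fin.sum_univ_two, extendU_mulVec_zero hU, extendQ, Matrix.kronecker, h, mul_assoc]
    · intro x _ hx
      simp [Fin.sum_univ_two, extendU_mulVec_zero hU, extendQ, Matrix.kronecker, h, hx.symm]
    · simp
  · intro x _ hx
    simp [extendQ, Matrix.kronecker, hx.symm]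
  · simp

theorem probZero_finalState (hU : LoadsScenarios U p ψ)
    (h : ∀ j j', Q (label j 0 0) (label j' 0 0) = if j = j' then ((f j : ℝ) : ℂ) else 0) :
    probZero (finalState U Q) = ∑ j : Fin n → Fin 2, (p j).toReal * f j ^ 2 := by
  have ht : ∀ (j : Fin n → Fin 2) t b, label j t b (tWire n) = t := fun _ _ _ => rfl
  have hb : ∀ (j : Fin n → Fin 2) t b, label j t b (bWire n) = b := fun _ _ _ => rfl
  rw [probZero, Fintype.sum_prod_type]
  simp only [sum_label, Fin.sum_univ_two, ht, hb]
  simp only [and_self, if_true, one_ne_zero, and_false, false_and, if_false, add_zero]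
  rw [Finset.sum_comm]
  refine Finset.sum_congr rfl fun j _ => ?_
  simp only [finalState_label_zero hU h, norm_mul, mul_pow, Complex.norm_real, Real.norm_eq_abs,
    sq_abs, Real.sq_sqrt ENNReal.toReal_nonneg]
  rw [← Finset.mul_sum, hU.normalized, mul_one, mul_comm]

end Full

/-! ### Error of the measured probability -/

theorem sum_toReal_pmf {ι : Type*} [Fintype ι] (p : PMF ι) : ∑ j, (p j).toReal = 1 := by
  rw [← ENNReal.toReal_sum fun j _ => p.apply_ne_top j, ← tsum_fintype (L := .unconditional _),
    p.tsum_coe, ENNReal.toReal_one]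

/-- The error of the squared polynomial against the squared threshold function. -/
theorem ApproxThreshold.abs_sum_sub_le {ι : Type*} [Fintype ι] {P : ℝ[X]} {k μ ε δ : ℝ}
    (hP : ApproxThreshold P k μ ε δ) (hk : 0 < k) (hε : 0 < ε) (p : PMF ι) (x : ι → ℝ)
    (hx : ∀ j, x j ∈ Set.Icc (-1 : ℝ) 1) :
    |∑ j, (p j).toReal * P.eval (x j) ^ 2 - ∑ j with |x j| ≤ μ, k ^ 2 * (p j).toReal| ≤
      ε * (2 * k + ε) + 5 / 4 * k ^ 2 * ∑ j with abs (|x j| - μ) ≤ δ, (p j).toReal := by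
  have hle : ∀ (v η t : ℝ), 0 ≤ η → (t = 0 ∨ t = 1) → |v - k * t| ≤ η →
      |v ^ 2 - k ^ 2 * t| ≤ η * (2 * k + η) := by
    intro v η t hη ht hv
    -- Uses t² = t.
    have h1 : v ^ 2 - k ^ 2 * t = (v - k * t) * ((v - k * t) + 2 * (k * t)) := by
      rcases ht with rfl | rfl <;> ring
    rw [h1, abs_mul]
    refine mul_le_mul hv ?_ (abs_nonneg _) hη
    have h2 : |2 * (k * t)| ≤ 2 * k := by
      rcases ht with rfl | rfl
      · simp [hk.le]
      · rw [mul_one, abs_of_pos (by linarith)]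
    linarith [abs_add_le (v - k * t) (2 * (k * t))]
  have ht : ∀ j, threshold μ (x j) = 0 ∨ threshold μ (x j) = 1 := fun j => by
    unfold threshold; split_ifs <;> simp
  have hterm : ∀ j, |P.eval (x j) ^ 2 - k ^ 2 * threshold μ (x j)| ≤
      ε * (2 * k + ε) + 5 / 4 * k ^ 2 * (if abs (|x j| - μ) ≤ δ then 1 else 0) := by
    intro j
    split_ifs with h
    -- Error k/2 gives (k/2)(2k + k/2) = (5/4)k².
    · have := hle _ _ _ (by linarith) (ht j) (hP.near _ (hx j) h)
      nlinarith [mul_pos hε hk]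
    · have := hle _ _ _ hε.le (ht j) (hP.far _ (hx j) (not_le.1 h)).le
      linarith
  calc |∑ j, (p j).toReal * P.eval (x j) ^ 2 - ∑ j with |x j| ≤ μ, k ^ 2 * (p j).toReal|
      = |∑ j, (p j).toReal * (P.eval (x j) ^ 2 - k ^ 2 * threshold μ (x j))| := by
        rw [Finset.sum_filter, ← Finset.sum_sub_distrib]
        congr 1
        refine Finset.sum_congr rfl fun j _ => ?_
        unfold threshold
        split_ifs <;> ring
    _ ≤ ∑ j, (p j).toReal * |P.eval (x j) ^ 2 - k ^ 2 * threshold μ (x j)| := by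
        refine (Finset.abs_sum_le_sum_abs _ _).trans (le_of_eq ?_)
        refine Finset.sum_congr rfl fun j _ => ?_
        rw [abs_mul, abs_of_nonneg ENNReal.toReal_nonneg]
    _ ≤ ∑ j, (p j).toReal *
          (ε * (2 * k + ε) + 5 / 4 * k ^ 2 * (if abs (|x j| - μ) ≤ δ then 1 else 0)) :=
        Finset.sum_le_sum fun j _ =>
          mul_le_mul_of_nonneg_left (hterm j) ENNReal.toReal_nonneg
    _ = (∑ j, (p j).toReal) * (ε * (2 * k + ε)) +
          5 / 4 * k ^ 2 * ∑ j with abs (|x j| - μ) ≤ δ, (p j).toReal := by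
        rw [Finset.sum_filter, Finset.mul_sum, Finset.sum_mul, ← Finset.sum_add_distrib]
        refine Finset.sum_congr rfl fun j _ => ?_
        split_ifs <;> ring
    _ = _ := by rw [sum_toReal_pmf, one_mul]

/-! ### The cumulative distribution function -/

theorem norm_geom_sum_mul_le {ω : ℂ} (hω : ‖ω‖ = 1) (N : ℕ) :
    ‖∑ k ∈ Finset.range N, ω ^ k‖ * ‖ω - 1‖ ≤ 2 := by
  rw [← norm_mul, geom_sum_mul]
  refine (norm_sub_le _ _).trans ?_
  rw [norm_pow, hω, one_pow, norm_one]
  norm_num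

/-- If the sine of an additive function plus a constant is nonnegative on an interval, then the
additive function is close to a multiple of `2π` at some small arguments. -/
theorem exists_norm_exp_sub_one_lt {θ : ℝ →+ ℝ} {θ₀ a : ℝ} (ha : 0 < a)
    (h : ∀ x ∈ Set.Ico 0 a, 0 ≤ Real.sin (θ x + θ₀)) {ε : ℝ} (hε : 0 < ε) :
    ∃ x ∈ Set.Ioc 0 a, ‖Complex.exp (θ x * Complex.I) - 1‖ < ε := by
  -- The summand 2 ensures 2a/N ≤ a; 10/ε is what the exponential sums below require.
  obtain ⟨N, hN⟩ := exists_nat_gt (10 / ε + 2)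
  have hN2 : (2 : ℝ) < N := by
    have : 0 < 10 / ε := by positivity
    linarith
  have hN0 : (0 : ℝ) < N := by linarith
  refine ⟨2 * (a / N), ⟨by positivity, ?_⟩, ?_⟩
  · rw [← mul_div_assoc, div_le_iff₀ hN0]; nlinarith
  set ω := Complex.exp (θ (a / N) * Complex.I) with hω
  have hω1 : ‖ω‖ = 1 := Complex.norm_exp_ofReal_mul_I _
  have hω2 : Complex.exp (θ (2 * (a / N)) * Complex.I) = ω ^ 2 := by
    rw [two_mul, map_add, hω, ← Complex.exp_nat_mul]
    congr 1; push_cast; ring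
  rw [hω2]
  by_contra! hge
  set y : ℕ → ℝ := fun k => θ (k * (a / N)) + θ₀ with hy
  have hexp : ∀ k, Complex.exp (y k * Complex.I) = Complex.exp (θ₀ * Complex.I) * ω ^ k := by
    intro k
    rw [hy, hω, ← Complex.exp_nat_mul, ← Complex.exp_add]
    congr 1
    simp only
    rw [← nsmul_eq_mul, map_nsmul, nsmul_eq_mul]
    push_cast; ring
  have hsin0 : ∀ k ∈ Finset.range N, 0 ≤ Real.sin (y k) := fun k hk => by
    refine h _ ⟨by positivity, ?_⟩
    have : (k : ℝ) < N := by exact_mod_cast Finset.mem_range.1 hk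
    rw [← mul_div_assoc, div_lt_iff₀ hN0]
    nlinarith
  have h1 : ∑ k ∈ Finset.range N, Real.sin (y k) ≤ ‖∑ k ∈ Finset.range N, ω ^ k‖ := by
    have h2 : ∑ k ∈ Finset.range N, Real.sin (y k) =
        (Complex.exp (θ₀ * Complex.I) * ∑ k ∈ Finset.range N, ω ^ k).im := by
      rw [Finset.mul_sum, Complex.im_sum]
      refine Finset.sum_congr rfl fun k _ => ?_
      rw [← hexp, Complex.exp_ofReal_mul_I_im]
    rw [h2]
    refine (Complex.im_le_norm _).trans ?_
    rw [norm_mul, Complex.norm_exp_ofReal_mul_I, one_mul]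
  have h2 : ∑ k ∈ Finset.range N, Real.cos (2 * y k) ≤
      ‖∑ k ∈ Finset.range N, (ω ^ 2) ^ k‖ := by
    have h2 : ∑ k ∈ Finset.range N, Real.cos (2 * y k) =
        (Complex.exp (θ₀ * Complex.I) ^ 2 * ∑ k ∈ Finset.range N, (ω ^ 2) ^ k).re := by
      rw [Finset.mul_sum, Complex.re_sum]
      refine Finset.sum_congr rfl fun k _ => ?_
      rw [← pow_mul, mul_comm 2 k, pow_mul, ← mul_pow, ← hexp, ← Complex.exp_nat_mul,
        ← Complex.exp_ofReal_mul_I_re]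
      congr 2; push_cast; ring
    rw [h2]
    refine (Complex.re_le_norm _).trans ?_
    rw [norm_mul, norm_pow, Complex.norm_exp_ofReal_mul_I, one_pow, one_mul]
  -- For 0 ≤ sin y ≤ 1, cos 2y + 2 sin y = 1 + 2 sin y (1 - sin y) ≥ 1.
  have h3 : (N : ℝ) ≤ ‖∑ k ∈ Finset.range N, (ω ^ 2) ^ k‖ +
      2 * ‖∑ k ∈ Finset.range N, ω ^ k‖ := by
    have h4 : ∑ k ∈ Finset.range N, (1 : ℝ) ≤ ∑ k ∈ Finset.range N,
        (Real.cos (2 * y k) + 2 * Real.sin (y k)) := by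
      refine Finset.sum_le_sum fun k hk => ?_
      rw [Real.cos_two_mul, Real.cos_sq']
      nlinarith [hsin0 k hk, Real.sin_le_one (y k)]
    rw [Finset.sum_add_distrib, ← Finset.mul_sum] at h4
    simp only [Finset.sum_const, Finset.card_range, nsmul_eq_mul, mul_one] at h4
    linarith
  have h4 := norm_geom_sum_mul_le hω1 N
  have h5 := norm_geom_sum_mul_le (ω := ω ^ 2) (by rw [norm_pow, hω1, one_pow]) N
  have h6 : ε ≤ ‖ω - 1‖ * 2 := by
    refine hge.trans ?_
    rw [show ω ^ 2 - 1 = (ω - 1) * (ω + 1) by ring, norm_mul]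
    -- |ω + 1| ≤ 2, so |ω - 1| ≥ ε/2; the geometric sums are then at most 2/ε and 4/ε, and N ≤ 2/ε +
    -- 2 · 4/ε.
    gcongr
    refine (norm_add_le _ _).trans ?_
    rw [hω1, norm_one]; norm_num
  have h7 : (N : ℝ) * ε ≤ 10 := by
    have h8 := mul_le_mul_of_nonneg_right h3 hε.le
    have h9 := mul_le_mul_of_nonneg_left hge (norm_nonneg (∑ k ∈ Finset.range N, (ω ^ 2) ^ k))
    have h10 := mul_le_mul_of_nonneg_left h6 (norm_nonneg (∑ k ∈ Finset.range N, ω ^ k))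
    nlinarith
  have h8 : 10 / ε < N := by linarith
  rw [div_lt_iff₀ hε] at h8
  linarith

/-- Take x in (0, a] with e^{iθ(x)} close to 1. Then a - x lies in [0, a), and the sines at a and a
- x are close by additivity. -/
theorem abs_sin_le_of_forall_Ico {θ : ℝ →+ ℝ} {θ₀ a μ : ℝ} (ha : 0 < a)
    (h : ∀ x ∈ Set.Ico 0 a, Real.sin (θ x + θ₀) ∈ Set.Ico 0 μ) :
    |Real.sin (θ a + θ₀)| ≤ μ := by
  refine le_of_forall_pos_lt_add fun ε hε => ?_
  obtain ⟨x, hx, hxε⟩ := exists_norm_exp_sub_one_lt ha (fun x hx => (h x hx).1) hε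
  have h1 := h (a - x) ⟨by linarith [hx.2], by linarith [hx.1]⟩
  set y := θ (a - x) + θ₀
  have h2 : θ a + θ₀ = θ x + y := by
    have : θ a = θ (a - x) + θ x := by rw [← map_add, sub_add_cancel]
    rw [this]; ring
  have h3 : |Real.sin (θ a + θ₀) - Real.sin y| < ε := by
    have h4 : Real.sin (θ a + θ₀) - Real.sin y =
        (Complex.exp (y * Complex.I) * (Complex.exp (θ x * Complex.I) - 1)).im := by
      rw [mul_sub, mul_one, ← Complex.exp_add, Complex.sub_im, Complex.exp_ofReal_mul_I_im, h2,
        ← Complex.exp_ofReal_mul_I_im (θ x + y)]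
      congr 3; push_cast; ring
    rw [h4]
    refine (Complex.abs_im_le_norm _).trans_lt ?_
    rwa [norm_mul, Complex.norm_exp_ofReal_mul_I, one_mul]
  have h5 := abs_lt.1 h3
  rw [abs_lt]
  constructor <;> linarith [h1.1, h1.2]

theorem lossCDF_eq_sum {n : ℕ} (p : PMF (Fin n → Fin 2)) (l : Fin n → ℝ) (x : ℝ) :
    lossCDF p l x = ∑ j : Fin n → Fin 2 with totalLoss l j ≤ x, (p j).toReal := by
  have hm : Measurable (totalLoss l) := Measurable.of_discrete
  have : MeasureTheory.IsProbabilityMeasure (p.toMeasure.map (totalLoss l)) :=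
    MeasureTheory.Measure.isProbabilityMeasure_map hm.aemeasurable
  rw [lossCDF, ProbabilityTheory.cdf_eq_real, MeasureTheory.measureReal_def,
    MeasureTheory.Measure.map_apply hm measurableSet_Iic,
    PMF.toMeasure_apply_fintype, ENNReal.toReal_sum, Finset.sum_filter]
  · refine Finset.sum_congr rfl fun j _ => ?_
    by_cases h : totalLoss l j ≤ x <;> simp [Set.indicator, h]
  · intro j _
    by_cases h : totalLoss l j ≤ x <;> simp [Set.indicator, h, p.apply_ne_top]

/-- The two index sets coincide: the image hypotheses decide every scenario with loss different from
`L`, and a loss equal to `L` is the boundary case of `abs_sin_le_of_forall_Ico`. -/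
theorem sum_abs_sin_le_eq_lossCDF {n : ℕ} {l : Fin n → ℝ} {θ : ℝ →+ ℝ} {θ₀ : ℝ}
    (p : PMF (Fin n → Fin 2)) (k : ℝ) {μ L : ℝ} (hl : ∀ i, 0 ≤ l i) (hL : 0 < L)
    (h1 : (fun x => Real.sin (θ x + θ₀)) '' Set.Ico 0 L ⊆ Set.Ico 0 μ)
    (h2 : (fun x => Real.sin (θ x + θ₀)) '' Set.Ioc L (maxLoss l) ⊆ Set.Ioc μ 1) :
    ∑ j : Fin n → Fin 2 with |Real.sin (angle l θ θ₀ j)| ≤ μ, k ^ 2 * (p j).toReal =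
      k ^ 2 * lossCDF p l L := by
  have h1' : ∀ x ∈ Set.Ico 0 L, Real.sin (θ x + θ₀) ∈ Set.Ico 0 μ := fun x hx => h1 ⟨x, hx, rfl⟩
  rw [lossCDF_eq_sum, Finset.mul_sum]
  congr 1
  ext j
  simp only [Finset.mem_filter, Finset.mem_univ, true_and]
  have h0 : 0 ≤ totalLoss l j :=
    Finset.sum_nonneg fun i _ => mul_nonneg (Nat.cast_nonneg _) (hl i)
  have hmax : totalLoss l j ≤ maxLoss l := by
    refine Finset.sum_le_sum fun i _ => mul_le_mul_of_nonneg_right ?_ (hl i)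
    have : ((j i : Fin 2) : ℕ) ≤ ((1 : Fin 2) : ℕ) := by have := (j i).isLt; simp; omega
    exact_mod_cast this
  rw [angle, add_comm]
  rcases lt_trichotomy (totalLoss l j) L with h | h | h
  · have := h1' _ ⟨h0, h⟩
    rw [abs_of_nonneg this.1]
    exact ⟨fun _ => h.le, fun _ => this.2.le⟩
  · rw [h]
    exact ⟨fun _ => le_rfl, fun _ => abs_sin_le_of_forall_Ico hL h1'⟩
  · have := (h2 ⟨_, ⟨h, hmax⟩, rfl⟩).1
    exact ⟨fun h' => absurd (this.trans_le (le_abs_self _)) (not_lt.2 h'),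
      fun h' => absurd h (not_lt.2 h')⟩

end LossCDF

end

/-! ### The main theorem -/

open LossCDF in
theorem mainTheorem1 :
    -- action of the amplitude-loading circuit `A`, and `|1⟩⟨1|_T A |0⟩⟨0|_T`
    (∀ (n : ℕ) (l : Fin n → ℝ) (θ : ℝ →+ ℝ) (θ₀ : ℝ),
      (∀ (j : Fin n → Fin 2) (b : Fin 2),
        (loadOp l θ θ₀).mulVec (ket j 0 b) =
          ((Real.cos (θ₀ + θ (totalLoss l j)) : ℝ) : ℂ) • ket j 0 b +
          ((Real.sin (θ₀ + θ (totalLoss l j)) : ℝ) : ℂ) • ket j 1 b) ∧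
      wireProj (tWire n) 1 * loadOp l θ θ₀ * wireProj (tWire n) 0 =
        ∑ j : Fin n → Fin 2, ∑ b : Fin 2,
          ((Real.sin (θ₀ + θ (totalLoss l j)) : ℝ) : ℂ) • ketbra (ket j 1 b) (ket j 0 b)) ∧
    -- approximating polynomials exist
    (∀ k μ ε δ : ℝ, 0 < k → k < 1 → 0 < μ → μ < 1 → 0 < ε → 0 < δ →
      ∃ P : Polynomial ℝ, Admissible P ∧ ApproxThreshold P k μ ε δ) ∧
    -- QSVT: the phases depend on the polynomial only
    (∀ P : Polynomial ℝ, Admissible P →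
      ∃ Φ : Fin P.natDegree → ℝ,
        ∀ (n : ℕ) (l : Fin n → ℝ) (θ : ℝ →+ ℝ) (θ₀ : ℝ),
          wireProj (bWire n) 0 * wireProj (tWire n) 0 * qOp l θ θ₀ Φ *
              wireProj (tWire n) 0 * wireProj (bWire n) 0 =
            ∑ j : Fin n → Fin 2,
              ((P.eval (Real.sin (angle l θ θ₀ j)) : ℝ) : ℂ) • ketbra (ket j 0 0) (ket j 0 0) ∧
          ∀ (z : ℕ)
            (U : Matrix ((Fin z → Fin 2) × (Fin n → Fin 2))
              ((Fin z → Fin 2) × (Fin n → Fin 2)) ℂ)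
            (p : PMF (Fin n → Fin 2)) (ψ : (Fin n → Fin 2) → (Fin z → Fin 2) → ℂ),
            LoadsScenarios U p ψ →
              (∀ (a : Fin z → Fin 2) (j : Fin n → Fin 2),
                finalState U (qOp l θ θ₀ Φ) (a, label j 0 0) =
                  ((P.eval (Real.sin (angle l θ θ₀ j)) * Real.sqrt (p j).toReal : ℝ) : ℂ) *
                    ψ j a) ∧
              probZero (finalState U (qOp l θ θ₀ Φ)) =
                ∑ j : Fin n → Fin 2, (p j).toReal * P.eval (Real.sin (angle l θ θ₀ j)) ^ 2 ∧
              ∀ k μ ε δ : ℝ, 0 < k → k < 1 → 0 < μ → μ < 1 → 0 < ε → 0 < δ →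
                ApproxThreshold P k μ ε δ →
                |probZero (finalState U (qOp l θ θ₀ Φ)) -
                    ∑ j : Fin n → Fin 2 with |Real.sin (angle l θ θ₀ j)| ≤ μ,
                      k ^ 2 * (p j).toReal| ≤
                  ε * (2 * k + ε) +
                    5 / 4 * k ^ 2 *
                      ∑ j : Fin n → Fin 2 with abs (|Real.sin (angle l θ θ₀ j)| - μ) ≤ δ,
                        (p j).toReal) ∧
    -- identification with the cumulative distribution function
    (∀ (n : ℕ) (l : Fin n → ℝ) (θ : ℝ →+ ℝ) (θ₀ : ℝ) (p : PMF (Fin n → Fin 2)) (k μ L_T : ℝ),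
      (∀ i, 0 ≤ l i) → 0 < k → k < 1 → 0 < μ → μ < 1 → 0 < L_T → L_T < maxLoss l →
      (fun x => Real.sin (θ x + θ₀)) '' Set.Ico 0 L_T ⊆ Set.Ico 0 μ →
      (fun x => Real.sin (θ x + θ₀)) '' Set.Ioc L_T (maxLoss l) ⊆ Set.Ioc μ 1 →
      ∑ j : Fin n → Fin 2 with |Real.sin (angle l θ θ₀ j)| ≤ μ, k ^ 2 * (p j).toReal =
        k ^ 2 * lossCDF p l L_T) ∧
    -- the circuit that implements `Q`, and its depth
    (∀ (n d : ℕ) (l : Fin n → ℝ) (θ : ℝ →+ ℝ) (θ₀ : ℝ) (Φ : Fin d → ℝ),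
      (qsvtCircuit l θ θ₀ Φ).toMatrix = qOp l θ θ₀ Φ) ∧
    (∃ K : ℕ, ∀ (n d : ℕ) (l : Fin n → ℝ) (θ : ℝ →+ ℝ) (θ₀ : ℝ) (Φ : Fin d → ℝ),
      1 ≤ n → 1 ≤ d → (qsvtCircuit l θ θ₀ Φ).depth ≤ K * (d * n)) := by
  refine ⟨fun n l θ θ₀ => ⟨loadOp_mulVec_ket l θ θ₀, wireProj_mul_loadOp_mul_wireProj l θ θ₀⟩,
    fun k μ ε δ hk hk1 hμ hμ1 hε hδ => exists_admissible_approxThreshold hk hk1 hμ hμ1 hε hδ,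
    fun P hP => ?_,
    fun n l θ θ₀ p k μ L hl _ _ _ _ hL _ h1 h2 => sum_abs_sin_le_eq_lossCDF p k hl hL h1 h2,
    fun n d l θ θ₀ Φ => toMatrix_qsvtCircuit l θ θ₀ Φ,
    7, fun n d l θ θ₀ Φ hn hd => depth_qsvtCircuit_le l θ θ₀ Φ hn hd⟩
  obtain ⟨φ, hφ⟩ := hP.exists_phases
  -- The sign comes from moving the X's through the phases in `alternatingProd_neg`.
  refine ⟨-φ, fun n l θ θ₀ => ?_⟩
  have hQ : ∀ j j', qOp l θ θ₀ (-φ) (label j 0 0) (label j' 0 0) =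
      if j = j' then ((P.eval (Real.sin (angle l θ θ₀ j)) : ℝ) : ℂ) else 0 := fun j j' => by
    rw [qOp_label_zero l θ θ₀ φ hP.even_natDegree, hφ _ _ (Real.sin_sq_add_cos_sq _)]
  refine ⟨proj_mul_qOp_mul_proj hQ, fun z U p ψ hU =>
    ⟨finalState_label_zero hU hQ, probZero_finalState hU hQ, ?_⟩⟩
  intro k μ ε δ hk _ _ _ hε _ hA
  rw [probZero_finalState hU hQ]
  exact hA.abs_sum_sub_le hk hε p _ fun j => Real.sin_mem_Icc _
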